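/- Let $d,n\ge 1$ be integers and let $d\mu=(2\pi)^{-d/2}e^{-|x|^2/2}\,dx$ be the standard Gaussian measure on $\mathbb R^d$. For $k\in\mathbb N^d$ put $|k|=\sum_j k_j$ and $H_k(x)=\prod_{j=1}^d h_{k_j}(x_j)$, where $h_m(y)=(-1)^m(m!)^{-1/2}e^{y^2/2}\frac{d^m}{dy^m}e^{-y^2/2}$ are the normalized Hermite polynomials. Let $h_1^*(s)=\dfrac{s\log s-(s-1)}{(s-1)^2}$ for $s\in(0,1)\cup(1,\infty)$, $h_1^*(0)=1$, $h_1^*(1)=\tfrac12$, and for $0\le w\in L^\infty(\mathbb R^d)$ let $\mathcal H_1[w]=\|w\|_\infty\,h_1^*(\inf w)$, with the essential supremum and infimum. Call $w$ admissible if $w\in L^\infty(\mathbb R^d)$, $w\ge 0$ a.e., $\int w\,d\mu=1$, and $\int w\,H_k\,d\mu=0$ for all $k\in\mathbb N^d$ with $0<|k|<n$. Then every admissible $w$ satisfies $$\int_{\mathbb R^d} w\log w\,d\mu\;\le\;\frac{\mathcal H_1[w]}{n}\int_{\mathbb R^d}\frac{|\nabla w|^2}{w}\,d\mu ,$$ where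 $\nabla w$ is the weak gradient and the right-hand side is $+\infty$ if $w$ has no locally integrable weak gradient. The constant $1/n$ is optimal: for all real $c<1/n$ and $\delta>0$ there is a smooth admissible $w$ with $|w-1|\le\delta$ on $\mathbb R^d$ such that $\int w\log w\,d\mu>c\,\mathcal H_1[w]\int\frac{|\nabla w|^2}{w}\,d\mu$. -/

import Mathlib

open MeasureTheory
open scoped ENNReal ContDiff

noncomputable section

namespace ImprovedLogSobolev

/-- `ℝ^d` with its Euclidean norm. -/
abbrev Space (d : ℕ) : Type := EuclideanSpace ℝ (Fin d)

/-- The Gaussian probability measure `dμ = (2π)^{-d/2} exp(-|x|²/2) dx` on `ℝ^d`. -/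
def gaussian (d : ℕ) : Measure (Space d) :=
  (volume : Measure (Space d)).withDensity fun x =>
    ENNReal.ofReal ((2 * Real.pi) ^ (-(d : ℝ) / 2) * Real.exp (-‖x‖ ^ 2 / 2))

/-- The normalized one-dimensional Hermite polynomial
`h_n(y) = (-1)^n (n!)^{-1/2} exp(y²/2) (d/dy)^n exp(-y²/2)`; `Polynomial.hermite` is the
monic (probabilists') one. -/
def hermite1 (n : ℕ) (y : ℝ) : ℝ :=
  Polynomial.aeval y (Polynomial.hermite n) / Real.sqrt (n.factorial : ℝ)

/-- The normalized Hermite polynomial `H_k(x) = ∏_j h_{k_j}(x_j)` with multi-index `k`. -/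
def hermiteMulti {d : ℕ} (k : Fin d → ℕ) (x : Space d) : ℝ :=
  ∏ j, hermite1 (k j) (x j)

/-- The continuous function `h₁` on `[0, ∞)`, with `h₁(1) = 1/2`
(the formula gives `h₁(0) = 1`, since `0 * log 0 = 0`). -/
def h1 (s : ℝ) : ℝ :=
  if s = 1 then 1 / 2 else (s * Real.log s - (s - 1)) / (s - 1) ^ 2

/-- `𝓗₁[w] = ‖w‖_∞ h₁(inf w)`, for `w ∈ L^∞`: norm and infimum are the essential ones. -/
def H1 {d : ℕ} (w : Space d → ℝ) : ℝ :=
  (eLpNorm w ∞ volume).toReal * h1 (essInf w volume)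

/-- `g` is the weak (distributional) gradient of `w` on `ℝ^d`. -/
structure HasWeakGradient {d : ℕ} (w : Space d → ℝ) (g : Space d → Space d) : Prop where
  locallyIntegrable : LocallyIntegrable w volume
  locallyIntegrable_grad : LocallyIntegrable g volume
  integral_eq : ∀ φ : Space d → ℝ, ContDiff ℝ ∞ φ → HasCompactSupport φ → ∀ i : Fin d,
    ∫ x, w x * fderiv ℝ φ x (EuclideanSpace.single i 1) = -∫ x, g x i * φ x

/-- The Fisher information `∫ |∇w|² / w dμ ∈ [0, ∞]`, with `∇w` the weak gradient.
The weak gradient is unique up to a null set, so the infimum is over at most one value;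
it is `∞` if `w` has no weak gradient. The quotient is the one of `[0, ∞]`, where
`0 / 0 = 0` and `a / 0 = ∞` for `a > 0`. -/
def fisher {d : ℕ} (w : Space d → ℝ) : ℝ≥0∞ :=
  ⨅ (g : Space d → Space d) (_ : HasWeakGradient w g),
    ∫⁻ x, ‖g x‖ₑ ^ 2 / ENNReal.ofReal (w x) ∂(gaussian d)

/-- The entropy `∫ w log w dμ`. -/
def entropy {d : ℕ} (w : Space d → ℝ) : ℝ :=
  ∫ x, w x * Real.log (w x) ∂(gaussian d)

/-- Bounded nonnegative functions with `∫ w dμ = 1` and `∫ w H_k dμ = 0` for `0 < |k| < n`. -/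
structure Admissible {d : ℕ} (n : ℕ) (w : Space d → ℝ) : Prop where
  memLp_top : MemLp w ∞ volume
  nonneg : ∀ᵐ x, 0 ≤ w x
  integral_eq_one : ∫ x, w x ∂(gaussian d) = 1
  integral_hermite : ∀ k : Fin d → ℕ, 0 < ∑ j, k j → ∑ j, k j < n →
    ∫ x, w x * hermiteMulti k x ∂(gaussian d) = 0

end ImprovedLogSobolev

end

/-! Taylor's formula `s log s = (s - 1) + h₁(s) (s - 1)²` with `h₁` decreasing gives
`∫ w log w dμ ≤ h₁(inf w) Var[w]`. Expansion in Hermite polynomials turns the vanishing of the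
modes of order `0 < |k| < n` into the Poincaré inequality `n Var[w] ≤ ∫ |∇w|² dμ`, and
`|∇w|² ≤ ‖w‖_∞ |∇w|² / w`.

For optimality, let `|k| = n`. A perturbation `1 + ε H_k` saturates these bounds to leading order
as `ε → 0`, but it is unbounded. If `ρ` is the Gaussian density, the function `f_s` defined by
`f_s(x) ρ(x) = (H_k ρ)(s x)` with `s > 1` is bounded, and it is still orthogonal to all `H_l` with
`|l| < n`, since dilations preserve the space of polynomials of degree less than `n`. It tends to
`H_k` as `s → 1`, so `1 + ε f_s` does the job. -/

open MeasureTheory Filter Topology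
open scoped ENNReal ContDiff Gradient ProbabilityTheory

noncomputable section

namespace ImprovedLogSobolev

/-! ### The function `h₁` -/

theorem mul_log_eq_add_h1_mul_sq (s : ℝ) :
    s * Real.log s = (s - 1) + h1 s * (s - 1) ^ 2 := by
  unfold h1
  split_ifs with h
  · simp [h]
  · have : s - 1 ≠ 0 := sub_ne_zero.2 h
    field_simp
    ring

theorem one_add_mul_sub_one_pos {s u : ℝ} (hs : 0 < s) (hu : u ∈ Set.Icc (0 : ℝ) 1) :
    0 < 1 + u * (s - 1) := by
  rcases eq_or_lt_of_le hu.1 with h | h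
  · simp [← h]
  · nlinarith [hu.2, mul_pos h hs]

theorem intervalIntegrable_one_sub_div {s : ℝ} (hs : 0 < s) :
    IntervalIntegrable (fun u : ℝ => (1 - u) / (1 + u * (s - 1))) volume 0 1 :=
  ContinuousOn.intervalIntegrable_of_Icc zero_le_one <|
    ContinuousOn.div (by fun_prop) (by fun_prop) fun _ hu => (one_add_mul_sub_one_pos hs hu).ne'

theorem integral_one_sub : ∫ u in (0 : ℝ)..1, (1 - u) = 1 / 2 := by
  rw [intervalIntegral.integral_sub (by simp) (by simp), integral_one, integral_id]
  norm_num

theorem hasDerivAt_h1_primitive {s u : ℝ} (hs : s ≠ 1) (hp : 1 + u * (s - 1) ≠ 0) :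
    HasDerivAt (fun u : ℝ => -u / (s - 1) + s / (s - 1) ^ 2 * Real.log (1 + u * (s - 1)))
      ((1 - u) / (1 + u * (s - 1))) u := by
  have hs' : s - 1 ≠ 0 := sub_ne_zero.2 hs
  have hline : HasDerivAt (fun u : ℝ => 1 + u * (s - 1)) (s - 1) u := by
    simpa using ((hasDerivAt_id u).mul_const (s - 1)).const_add 1
  refine (((hasDerivAt_id u).neg.div_const (s - 1)).add
    ((hline.log hp).const_mul (s / (s - 1) ^ 2))).congr_deriv ?_
  obtain ⟨p, hpu⟩ : ∃ p, p = 1 + u * (s - 1) := ⟨_, rfl⟩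
  rw [← hpu] at hp ⊢
  field_simp
  rw [hpu]
  ring

/- `h1 s` is the integral remainder of Taylor's formula for `s * log s` at `1`, divided by
`(s - 1) ^ 2`; in this form monotonicity is visible. -/
theorem h1_eq_integral {s : ℝ} (hs : 0 < s) :
    h1 s = ∫ u in (0 : ℝ)..1, (1 - u) / (1 + u * (s - 1)) := by
  rcases eq_or_ne s 1 with rfl | h
  · simp [h1, integral_one_sub]
  · have ha : s - 1 ≠ 0 := sub_ne_zero.2 h
    rw [intervalIntegral.integral_eq_sub_of_hasDerivAt (fun u hu => hasDerivAt_h1_primitive h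
      (one_add_mul_sub_one_pos hs (by rwa [Set.uIcc_of_le zero_le_one] at hu)).ne')
      (intervalIntegrable_one_sub_div hs), h1, if_neg h]
    simp only [one_mul, zero_mul, add_zero, add_sub_cancel, Real.log_one, mul_zero, neg_zero,
      zero_div, sub_zero]
    field_simp
    ring

theorem h1_zero : h1 0 = 1 := by simp [h1]

theorem h1_le_one {s : ℝ} (hs : 0 < s) : h1 s ≤ 1 := by
  rcases eq_or_ne s 1 with rfl | h
  · norm_num [h1]
  · rw [h1, if_neg h, div_le_one (by positivity [sub_ne_zero.2 h])]
    nlinarith [mul_le_mul_of_nonneg_left (Real.log_le_sub_one_of_pos hs) hs.le]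

theorem h1_le_h1_of_pos {s t : ℝ} (hs : 0 < s) (hst : s ≤ t) : h1 t ≤ h1 s := by
  rw [h1_eq_integral hs, h1_eq_integral (hs.trans_le hst)]
  refine intervalIntegral.integral_mono_on zero_le_one
    (intervalIntegrable_one_sub_div (hs.trans_le hst)) (intervalIntegrable_one_sub_div hs)
    fun u hu => ?_
  refine div_le_div_of_nonneg_left (by linarith [hu.2]) (one_add_mul_sub_one_pos hs hu) ?_
  have := hu.1
  gcongr

theorem antitoneOn_h1 : AntitoneOn h1 (Set.Ici 0) := by
  intro s hs t ht hst
  rcases eq_or_lt_of_le (Set.mem_Ici.1 hs) with rfl | h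
  · rcases eq_or_lt_of_le (Set.mem_Ici.1 ht) with rfl | h'
    · rfl
    · exact h1_zero ▸ h1_le_one h'
  · exact h1_le_h1_of_pos h hst

theorem h1_le_one_half_div {s : ℝ} (hs : 0 < s) (hs1 : s ≤ 1) : h1 s ≤ 1 / 2 / s := by
  rw [h1_eq_integral hs, ← integral_one_sub, ← intervalIntegral.integral_div]
  refine intervalIntegral.integral_mono_on zero_le_one (intervalIntegrable_one_sub_div hs)
    (Continuous.intervalIntegrable (by fun_prop) _ _) fun u hu => ?_
  refine div_le_div_of_nonneg_left (by linarith [hu.2]) hs ?_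
  nlinarith [hu.2]

theorem one_half_div_le_h1 {s : ℝ} (hs : 1 ≤ s) : 1 / 2 / s ≤ h1 s := by
  have hs0 : 0 < s := by linarith
  rw [h1_eq_integral hs0, ← integral_one_sub, ← intervalIntegral.integral_div]
  refine intervalIntegral.integral_mono_on zero_le_one
    (Continuous.intervalIntegrable (by fun_prop) _ _) (intervalIntegrable_one_sub_div hs0)
    fun u hu => ?_
  refine div_le_div_of_nonneg_left (by linarith [hu.2]) (one_add_mul_sub_one_pos hs0 hu) ?_
  nlinarith [hu.2]

theorem h1_pos {s : ℝ} (hs : 0 ≤ s) : 0 < h1 s :=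
  calc 0 < 1 / 2 / (s + 1) := by positivity
    _ ≤ h1 (s + 1) := one_half_div_le_h1 (by linarith)
    _ ≤ h1 s := antitoneOn_h1 hs (Set.mem_Ici.2 (by linarith)) (by linarith)

/-! ### The Gaussian measure -/

section Gaussian

/-- The density of the standard Gaussian measure with respect to Lebesgue measure. -/
def density (d : ℕ) (x : Space d) : ℝ :=
  (2 * Real.pi) ^ (-(d : ℝ) / 2) * Real.exp (-‖x‖ ^ 2 / 2)

variable {d : ℕ}

theorem density_pos (x : Space d) : 0 < density d x := by
  unfold density
  positivity

theorem contDiff_density : ContDiff ℝ ∞ (density d) := by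
  unfold density
  have : ContDiff ℝ ∞ (fun x : Space d => ‖x‖ ^ 2) := contDiff_norm_sq ℝ
  fun_prop

theorem measurable_ofReal_density : Measurable fun x => ENNReal.ofReal (density d x) :=
  contDiff_density.continuous.measurable.ennreal_ofReal

theorem gaussian_eq_withDensity :
    gaussian d = volume.withDensity fun x => ENNReal.ofReal (density d x) := rfl

theorem gaussian_absolutelyContinuous : gaussian d ≪ volume :=
  withDensity_absolutelyContinuous _ _

theorem integral_gaussian {E : Type*} [NormedAddCommGroup E] [NormedSpace ℝ E]
    (f : Space d → E) : ∫ x, f x ∂(gaussian d) = ∫ x, density d x • f x := by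
  rw [gaussian_eq_withDensity, integral_withDensity_eq_integral_toReal_smul
    measurable_ofReal_density (by simp)]
  simp only [ENNReal.toReal_ofReal (density_pos _).le]

theorem integrable_gaussian_iff {E : Type*} [NormedAddCommGroup E] [NormedSpace ℝ E]
    {f : Space d → E} :
    Integrable f (gaussian d) ↔ Integrable (fun x => density d x • f x) volume := by
  rw [gaussian_eq_withDensity, integrable_withDensity_iff_integrable_smul'
    measurable_ofReal_density (by simp)]
  simp only [ENNReal.toReal_ofReal (density_pos _).le]

theorem integral_density : ∫ x, density d x = 1 := by
  have hexp : ∀ x : Space d, Real.exp (-‖x‖ ^ 2 / 2) = Real.exp (-(1 / 2) * ‖x‖ ^ 2) := fun x => by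
    ring_nf
  have hpow : (2 * Real.pi) ^ (-(d : ℝ) / 2) * (2 * Real.pi) ^ ((d : ℝ) / 2) = 1 := by
    rw [← Real.rpow_add (by positivity), neg_div, neg_add_cancel, Real.rpow_zero]
  simp only [density, hexp]
  rw [integral_const_mul, GaussianFourier.integral_rexp_neg_mul_sq_norm (by positivity),
    finrank_euclideanSpace, Fintype.card_fin, div_div_eq_mul_div, div_one, mul_comm Real.pi, hpow]

instance isProbabilityMeasure_gaussian : IsProbabilityMeasure (gaussian d) := by
  have h : (gaussian d).real Set.univ = 1 := by
    simpa [integral_density] using integral_gaussian fun _ : Space d => (1 : ℝ)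
  exact ⟨(ENNReal.toReal_eq_one_iff _).1 h⟩

theorem integrable_exp_mul_norm (a : ℝ) :
    Integrable (fun x : Space d => Real.exp (a * ‖x‖)) (gaussian d) := by
  rw [integrable_gaussian_iff]
  have h := (GaussianFourier.integrable_cexp_neg_mul_sq_norm_add (V := Space d) (b := 1 / 4)
    (by norm_num) 0 0).norm.const_mul ((2 * Real.pi) ^ (-(d : ℝ) / 2) * Real.exp (a ^ 2))
  refine h.mono' (contDiff_density.continuous.smul (by fun_prop)).aestronglyMeasurable
    (Eventually.of_forall fun x => ?_)
  have hnorm : ‖Complex.exp (-(1 / 4) * ‖x‖ ^ 2 + 0 * inner ℝ 0 x)‖ =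
      Real.exp (-(1 / 4) * ‖x‖ ^ 2) := by
    rw [Complex.norm_exp]
    congr 1
    simp [← Complex.ofReal_pow]
  rw [hnorm, density, smul_eq_mul, Real.norm_of_nonneg (by positivity), mul_assoc, mul_assoc,
    ← Real.exp_add, ← Real.exp_add]
  refine mul_le_mul_of_nonneg_left (Real.exp_le_exp.2 ?_) (by positivity)
  nlinarith [sq_nonneg (a - ‖x‖ / 2)]

end Gaussian

/-! ### Functions of exponential growth -/

section ExpGrowth

variable {E F : Type*} [NormedAddCommGroup E] [NormedAddCommGroup F]

/-- Continuous functions of at most exponential growth: a class that contains polynomials, is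
stable under products and consists of functions in every `L^p(gaussian d)`, `p < ∞`. -/
def ExpGrowth (f : E → F) : Prop :=
  Continuous f ∧ ∃ C a : ℝ, ∀ x, ‖f x‖ ≤ C * Real.exp (a * ‖x‖)

namespace ExpGrowth

protected theorem continuous {f : E → F} (hf : ExpGrowth f) : Continuous f := hf.1

theorem of_bounded {f : E → F} (hf : Continuous f) {C : ℝ} (h : ∀ x, ‖f x‖ ≤ C) :
    ExpGrowth f :=
  ⟨hf, C, 0, by simpa using h⟩

protected theorem const (c : F) : ExpGrowth fun _ : E => c :=
  of_bounded continuous_const fun _ => le_rfl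

theorem clm [NormedSpace ℝ E] [NormedSpace ℝ F] (L : E →L[ℝ] F) : ExpGrowth L := by
  refine ⟨L.continuous, ‖L‖, 1, fun x => (L.le_opNorm x).trans ?_⟩
  gcongr
  linarith [Real.add_one_le_exp (1 * ‖x‖)]

theorem smul [NormedSpace ℝ F] {f : E → ℝ} {g : E → F} (hf : ExpGrowth f) (hg : ExpGrowth g) :
    ExpGrowth fun x => f x • g x := by
  obtain ⟨hfc, C, a, hf⟩ := hf
  obtain ⟨hgc, D, b, hg⟩ := hg
  refine ⟨hfc.smul hgc, C * D, a + b, fun x => ?_⟩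
  rw [norm_smul, add_mul, Real.exp_add, mul_mul_mul_comm]
  exact mul_le_mul (hf x) (hg x) (norm_nonneg _) ((norm_nonneg _).trans (hf x))

theorem mul {f g : E → ℝ} (hf : ExpGrowth f) (hg : ExpGrowth g) :
    ExpGrowth fun x => f x * g x :=
  hf.smul hg

protected theorem norm {f : E → F} (hf : ExpGrowth f) : ExpGrowth fun x => ‖f x‖ := by
  obtain ⟨hfc, C, a, hf⟩ := hf
  exact ⟨hfc.norm, C, a, by simpa only [norm_norm] using hf⟩

theorem add {f g : E → F} (hf : ExpGrowth f) (hg : ExpGrowth g) :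
    ExpGrowth fun x => f x + g x := by
  obtain ⟨hfc, C, a, hf⟩ := hf
  obtain ⟨hgc, D, b, hg⟩ := hg
  refine ⟨hfc.add hgc, |C| + |D|, max a b, fun x => ?_⟩
  calc ‖f x + g x‖ ≤ |C| * Real.exp (a * ‖x‖) + |D| * Real.exp (b * ‖x‖) :=
        (norm_add_le _ _).trans <| add_le_add
          ((hf x).trans (by gcongr; exact le_abs_self C))
          ((hg x).trans (by gcongr; exact le_abs_self D))
    _ ≤ |C| * Real.exp (max a b * ‖x‖) + |D| * Real.exp (max a b * ‖x‖) := by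
        gcongr
        · exact le_max_left a b
        · exact le_max_right a b
    _ = _ := (add_mul _ _ _).symm

theorem sum {ι : Type*} (s : Finset ι) {f : ι → E → F} (hf : ∀ i, ExpGrowth (f i)) :
    ExpGrowth fun x => ∑ i ∈ s, f i x := by
  classical
  induction s using Finset.induction_on with
  | empty => simpa using ExpGrowth.const (0 : F)
  | insert i s hi ih => simpa only [Finset.sum_insert hi] using (hf i).add ih

theorem prod {ι : Type*} (s : Finset ι) {f : ι → E → ℝ} (hf : ∀ i, ExpGrowth (f i)) :
    ExpGrowth fun x => ∏ i ∈ s, f i x := by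
  classical
  induction s using Finset.induction_on with
  | empty => simpa using ExpGrowth.const (1 : ℝ)
  | insert i s hi ih => simpa only [Finset.prod_insert hi] using (hf i).mul ih

theorem pow {f : E → ℝ} (hf : ExpGrowth f) (m : ℕ) : ExpGrowth fun x => f x ^ m := by
  simpa using prod (Finset.range m) fun _ => hf

theorem aeval {R : Type*} [CommSemiring R] [Algebra R ℝ] {f : E → ℝ} (hf : ExpGrowth f)
    (p : Polynomial R) : ExpGrowth fun x => Polynomial.aeval (f x) p := by
  simp only [Polynomial.aeval_eq_sum_range, Algebra.smul_def]
  exact sum _ fun m => (ExpGrowth.const _).mul (hf.pow m)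

theorem of_apply {d : ℕ} {f : E → Space d} (hf : ∀ i, ExpGrowth fun x => f x i) :
    ExpGrowth f := by
  have hsum : f = fun x => ∑ i, f x i • EuclideanSpace.single i (1 : ℝ) := by
    ext x j
    simp [Pi.single_apply]
  rw [hsum]
  exact sum _ fun i => (hf i).smul (ExpGrowth.const _)

theorem comp_smul [NormedSpace ℝ E] {f : E → F} (hf : ExpGrowth f) (s : ℝ) :
    ExpGrowth fun x => f (s • x) := by
  obtain ⟨hfc, C, a, hf⟩ := hf
  refine ⟨by fun_prop, C, a * |s|, fun x => ?_⟩
  simpa only [norm_smul, Real.norm_eq_abs, mul_assoc] using hf (s • x)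

theorem memLp {d : ℕ} {f : Space d → F} (hf : ExpGrowth f) {p : ℝ≥0∞} (hp : p ≠ ⊤) :
    MemLp f p (gaussian d) := by
  obtain ⟨hc, C, a, h⟩ := hf
  rcases eq_or_ne p 0 with rfl | hp0
  · exact memLp_zero_iff_aestronglyMeasurable.2 hc.aestronglyMeasurable
  have hexp : MemLp (fun x : Space d => Real.exp (a * ‖x‖)) p (gaussian d) := by
    rw [← integrable_norm_rpow_iff (Continuous.aestronglyMeasurable (by fun_prop)) hp0 hp]
    simpa only [Real.norm_eq_abs, Real.abs_exp, ← Real.exp_mul, mul_right_comm a] using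
      integrable_exp_mul_norm (a * p.toReal)
  exact hexp.of_le_mul hc.aestronglyMeasurable (Eventually.of_forall fun x => by
    simpa only [Real.norm_eq_abs, Real.abs_exp] using h x)

theorem memLp_two {d : ℕ} {f : Space d → F} (hf : ExpGrowth f) : MemLp f 2 (gaussian d) :=
  hf.memLp (by simp)

theorem integrable {d : ℕ} {f : Space d → F} (hf : ExpGrowth f) : Integrable f (gaussian d) :=
  memLp_one_iff_integrable.1 (hf.memLp (by simp))

end ExpGrowth

end ExpGrowth

/-! ### Gradients -/

section Gradient

variable {E : Type*} [NormedAddCommGroup E] [InnerProductSpace ℝ E] [CompleteSpace E]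

theorem gradient_fun_mul {f g : E → ℝ} {x : E} (hf : DifferentiableAt ℝ f x)
    (hg : DifferentiableAt ℝ g x) :
    ∇ (fun y => f y * g y) x = f x • ∇ g x + g x • ∇ f x := by
  simp only [gradient, fderiv_fun_mul hf hg, map_add, map_smulₛₗ, conj_trivial]

theorem gradient_comp_smul (f : E → ℝ) (s : ℝ) (x : E) :
    ∇ (fun y => f (s • y)) x = s • ∇ f (s • x) := by
  simp only [gradient, fderiv_comp_smul, map_smulₛₗ, conj_trivial]

theorem hasGradientAt_exp_neg_mul_norm_sq (b : ℝ) (x : E) :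
    HasGradientAt (fun y : E => Real.exp (-(b * ‖y‖ ^ 2 / 2)))
      (-(b * Real.exp (-(b * ‖x‖ ^ 2 / 2))) • x) x := by
  have h := ((hasStrictFDerivAt_norm_sq x).hasFDerivAt.const_mul b).mul_const (2 : ℝ)⁻¹
  refine hasGradientAt_iff_hasFDerivAt.2 (h.fun_neg.exp.congr_fderiv ?_)
  ext y
  simp only [neg_smul, map_neg, map_smul, neg_apply, smul_apply,
    InnerProductSpace.toDual_apply_apply, smul_eq_mul, smul_neg, coe_innerSL_apply, nsmul_eq_mul,
    Nat.cast_ofNat, div_eq_mul_inv]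
  ring

theorem gradient_apply {d : ℕ} (f : Space d → ℝ) (x : Space d) (i : Fin d) :
    ∇ f x i = fderiv ℝ f x (EuclideanSpace.single i 1) := by
  rw [← inner_gradient_left, EuclideanSpace.inner_single_right]
  simp

end Gradient

/-! ### Hermite polynomials -/

theorem derivative_hermite (n : ℕ) :
    Polynomial.derivative (Polynomial.hermite n) = n * Polynomial.hermite (n - 1) := by
  induction n with
  | zero => simp
  | succ n ih =>
    rw [Polynomial.hermite_succ, Polynomial.derivative_sub, Polynomial.derivative_mul, ih,
      Polynomial.derivative_X, Polynomial.derivative_natCast_mul, Nat.add_sub_cancel]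
    rcases n with _ | n
    · simp
    · rw [Nat.add_sub_cancel, Polynomial.hermite_succ n]
      push_cast
      ring

theorem hermite1_zero (y : ℝ) : hermite1 0 y = 1 := by simp [hermite1]

theorem sqrt_mul_hermite1_pred (n : ℕ) (y : ℝ) :
    √(n : ℝ) * hermite1 (n - 1) y =
      n * Polynomial.aeval y (Polynomial.hermite (n - 1)) / √(n.factorial : ℝ) := by
  rcases n with _ | n
  · simp
  · have hsq : √((n + 1 : ℕ) : ℝ) ^ 2 = ((n + 1 : ℕ) : ℝ) := Real.sq_sqrt (by positivity)
    rw [hermite1, Nat.factorial_succ, Nat.cast_mul, Real.sqrt_mul (by positivity),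
      Nat.add_sub_cancel]
    field_simp
    rw [hsq, mul_comm]

theorem hasDerivAt_hermite1 (n : ℕ) (y : ℝ) :
    HasDerivAt (hermite1 n) (√(n : ℝ) * hermite1 (n - 1) y) y := by
  have h := ((Polynomial.hermite n).hasDerivAt_aeval y).div_const √(n.factorial : ℝ)
  rw [derivative_hermite] at h
  rw [sqrt_mul_hermite1_pred]
  exact h.congr_deriv (by simp)

theorem sqrt_mul_hermite1_succ (n : ℕ) (y : ℝ) :
    √((n : ℝ) + 1) * hermite1 (n + 1) y = y * hermite1 n y - √(n : ℝ) * hermite1 (n - 1) y := by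
  rw [sqrt_mul_hermite1_pred, hermite1, hermite1, Polynomial.hermite_succ, derivative_hermite,
    Nat.factorial_succ, Nat.cast_mul, Real.sqrt_mul (by positivity)]
  simp only [Nat.cast_succ, map_sub, map_mul, Polynomial.aeval_X, map_natCast]
  field_simp

theorem contDiff_hermite1 (n : ℕ) : ContDiff ℝ ∞ (hermite1 n) :=
  (Polynomial.contDiff_aeval _ _).div_const _

section HermiteMulti

variable {d : ℕ}

theorem hermiteMulti_zero (x : Space d) : hermiteMulti 0 x = 1 := by
  simp [hermiteMulti, hermite1_zero]

theorem contDiff_hermiteMulti (k : Fin d → ℕ) : ContDiff ℝ ∞ (hermiteMulti k) := by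
  unfold hermiteMulti
  exact contDiff_prod fun j _ => (contDiff_hermite1 _).comp (by fun_prop)

theorem expGrowth_hermiteMulti (k : Fin d → ℕ) : ExpGrowth (hermiteMulti k) := by
  refine ExpGrowth.prod Finset.univ fun j => ?_
  simp only [hermite1, div_eq_mul_inv]
  exact ((ExpGrowth.clm (EuclideanSpace.proj j)).aeval _).mul (ExpGrowth.const _)

theorem hermiteMulti_eq_mul_prod_erase {k l : Fin d → ℕ} {i : Fin d} (h : ∀ j ≠ i, l j = k j)
    (x : Space d) :
    hermiteMulti l x = hermite1 (l i) (x i) * ∏ j ∈ Finset.univ.erase i, hermite1 (k j) (x j) := by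
  rw [hermiteMulti, ← Finset.mul_prod_erase _ _ (Finset.mem_univ i)]
  congr 1
  exact Finset.prod_congr rfl fun j hj => by rw [h j (Finset.ne_of_mem_erase hj)]

theorem hermiteMulti_sub_single (k : Fin d → ℕ) (i : Fin d) (x : Space d) :
    hermiteMulti (k - Pi.single i 1) x =
      hermite1 (k i - 1) (x i) * ∏ j ∈ Finset.univ.erase i, hermite1 (k j) (x j) := by
  rw [hermiteMulti_eq_mul_prod_erase (k := k) (l := k - Pi.single i 1) (i := i)
    fun j hj => by simp [hj], Pi.sub_apply, Pi.single_eq_same]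

theorem sqrt_mul_hermiteMulti_add_single (k : Fin d → ℕ) (i : Fin d) (x : Space d) :
    √((k i : ℝ) + 1) * hermiteMulti (k + Pi.single i 1) x =
      x i * hermiteMulti k x - √(k i : ℝ) * hermiteMulti (k - Pi.single i 1) x := by
  rw [hermiteMulti_sub_single,
    hermiteMulti_eq_mul_prod_erase (k := k) (l := k + Pi.single i 1) (i := i)
      fun j hj => by simp [hj],
    hermiteMulti_eq_mul_prod_erase (k := k) (l := k) (i := i) fun _ _ => rfl, Pi.add_apply,
    Pi.single_eq_same, ← mul_assoc, sqrt_mul_hermite1_succ]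
  ring

theorem gradient_hermiteMulti_apply (k : Fin d → ℕ) (x : Space d) (i : Fin d) :
    ∇ (hermiteMulti k) x i = √(k i : ℝ) * hermiteMulti (k - Pi.single i 1) x := by
  have hfactor : ∀ j ∈ Finset.univ, HasFDerivAt (fun x : Space d => hermite1 (k j) (x j))
      ((√(k j : ℝ) * hermite1 (k j - 1) (x j)) • (EuclideanSpace.proj j : Space d →L[ℝ] ℝ)) x :=
    fun j _ => (hasDerivAt_hermite1 (k j) (x j)).comp_hasFDerivAt
      (f := fun x : Space d => x j) x (EuclideanSpace.proj j : Space d →L[ℝ] ℝ).hasFDerivAt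
  have h : HasFDerivAt (hermiteMulti k) _ x := HasFDerivAt.finsetProd hfactor
  rw [gradient_apply, h.fderiv, hermiteMulti_sub_single]
  simp [mul_comm, mul_assoc]

theorem expGrowth_gradient_hermiteMulti (k : Fin d → ℕ) : ExpGrowth (∇ (hermiteMulti k)) :=
  ExpGrowth.of_apply fun i => by
    simp only [gradient_hermiteMulti_apply]
    exact (ExpGrowth.const _).mul (expGrowth_hermiteMulti _)

theorem gradient_density (x : Space d) : ∇ (density d) x = -density d x • x := by
  have hdensity : density d = fun y =>
      (2 * Real.pi) ^ (-(d : ℝ) / 2) * Real.exp (-(1 * ‖y‖ ^ 2 / 2)) := by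
    funext y
    simp only [density, one_mul, neg_div]
  rw [hdensity, gradient_fun_mul (differentiableAt_const _)
    (hasGradientAt_exp_neg_mul_norm_sq 1 x).differentiableAt,
    (hasGradientAt_exp_neg_mul_norm_sq 1 x).gradient, gradient_fun_const, smul_zero, add_zero,
    smul_smul]
  ring_nf

theorem gradient_hermiteMulti_mul_density (k : Fin d → ℕ) (i : Fin d) (x : Space d) :
    ∇ (fun x => hermiteMulti k x * density d x) x i =
      -(√((k i : ℝ) + 1) * hermiteMulti (k + Pi.single i 1) x * density d x) := by
  rw [gradient_fun_mul ((contDiff_hermiteMulti k).differentiable (by simp) x)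
    (contDiff_density.differentiable (by simp) x), sqrt_mul_hermiteMulti_add_single]
  simp only [PiLp.add_apply, PiLp.smul_apply, smul_eq_mul, gradient_hermiteMulti_apply,
    gradient_density]
  ring

end HermiteMulti

/-! ### Weak gradients -/

theorem exists_cutoff_seq (E : Type*) [NormedAddCommGroup E] [NormedSpace ℝ E]
    [FiniteDimensional ℝ E] :
    ∃ χ : ℕ → E → ℝ, (∀ m, ContDiff ℝ ∞ (χ m)) ∧ (∀ m, HasCompactSupport (χ m)) ∧
      (∀ m x, |χ m x| ≤ 1) ∧ (∃ K, ∀ m x, ‖fderiv ℝ (χ m) x‖ ≤ K) ∧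
      ∀ x, ∀ᶠ m in atTop, χ m =ᶠ[𝓝 x] fun _ => 1 := by
  let f : ContDiffBump (0 : E) := ⟨1, 2, one_pos, one_lt_two⟩
  let c : ℕ → ℝ := fun m => 1 / ((m : ℝ) + 1)
  have hc : ∀ m, 0 < c m := fun m => by positivity
  have hc1 : ∀ m, c m ≤ 1 := fun m => div_le_one_of_le₀ (by simp) (by positivity)
  have hct : Tendsto c atTop (𝓝 0) := tendsto_one_div_add_atTop_nhds_zero_nat
  obtain ⟨K, hK⟩ := (f.hasCompactSupport.fderiv ℝ).exists_bound_of_continuous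
    ((f.contDiff (n := 1)).continuous_fderiv one_ne_zero)
  refine ⟨fun m x => f (c m • x), fun m => f.contDiff.comp (contDiff_const_smul _),
    fun m => f.hasCompactSupport.comp_smul (hc m).ne', fun m x => ?_, ⟨K, fun m x => ?_⟩,
    fun x => ?_⟩
  · rw [abs_of_nonneg f.nonneg]
    exact f.le_one
  · rw [fderiv_comp_smul, norm_smul, Real.norm_of_nonneg (hc m).le]
    exact (mul_le_of_le_one_left (norm_nonneg _) (hc1 m)).trans (hK _)
  · have hball : ∀ᶠ m in atTop, c m • x ∈ Metric.ball (0 : E) 1 := by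
      have := hct.smul_const x
      rw [zero_smul] at this
      exact this.eventually_mem (Metric.ball_mem_nhds 0 one_pos)
    filter_upwards [hball] with m hm
    have hcont : Tendsto (fun y : E => c m • y) (𝓝 x) (𝓝 (c m • x)) :=
      (continuous_const_smul (c m)).continuousAt
    filter_upwards [hcont.eventually_mem (Metric.isOpen_ball.mem_nhds hm)] with y hy
    exact f.one_of_mem_closedBall (Metric.ball_subset_closedBall hy)

theorem tendsto_integral_mul_of_bounded {α : Type*} [MeasurableSpace α] {μ : Measure α}
    {f : α → ℝ} (hf : Integrable f μ) {a : ℕ → α → ℝ} (ham : ∀ m, AEStronglyMeasurable (a m) μ)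
    {K b : ℝ} (haK : ∀ m x, |a m x| ≤ K) (hab : ∀ x, Tendsto (fun m => a m x) atTop (𝓝 b)) :
    Tendsto (fun m => ∫ x, a m x * f x ∂μ) atTop (𝓝 (b * ∫ x, f x ∂μ)) := by
  rw [← integral_const_mul]
  refine tendsto_integral_of_dominated_convergence (fun x => K * ‖f x‖)
    (fun m => (ham m).mul hf.1) (hf.norm.const_mul K)
    (fun m => Eventually.of_forall fun x => ?_)
    (Eventually.of_forall fun x => (hab x).mul_const (f x))
  rw [norm_mul]
  exact mul_le_mul_of_nonneg_right (haK m x) (norm_nonneg _)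

section WeakGradient

variable {d : ℕ}

namespace HasWeakGradient

theorem integral_mul_fderiv_eq_neg {w : Space d → ℝ} {g : Space d → Space d}
    (h : HasWeakGradient w g) {F : Space d → ℝ} (hF : ContDiff ℝ ∞ F) {i : Fin d}
    (hwF : Integrable fun x => w x * F x)
    (hwF' : Integrable fun x => w x * fderiv ℝ F x (EuclideanSpace.single i 1))
    (hgF : Integrable fun x => g x i * F x) :
    ∫ x, w x * fderiv ℝ F x (EuclideanSpace.single i 1) = -∫ x, g x i * F x := by
  obtain ⟨χ, hχ, hχs, hχ1, ⟨K, hK⟩, hχlim⟩ := exists_cutoff_seq (Space d)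
  let e : Space d := EuclideanSpace.single i 1
  have hχ_lim : ∀ x, Tendsto (fun m => χ m x) atTop (𝓝 1) := fun x =>
    tendsto_const_nhds.congr' <| (hχlim x).mono fun m hm => hm.eq_of_nhds.symm
  have hχ'_lim : ∀ x, Tendsto (fun m => fderiv ℝ (χ m) x e) atTop (𝓝 0) := fun x =>
    tendsto_const_nhds.congr' <| (hχlim x).mono fun m hm => by simp [hm.fderiv_eq]
  have hχ'_le : ∀ m x, |fderiv ℝ (χ m) x e| ≤ K := fun m x =>
    ((fderiv ℝ (χ m) x).le_opNorm e).trans <| by simpa [e] using hK m x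
  have hχm : ∀ m, AEStronglyMeasurable (χ m) := fun m => (hχ m).continuous.aestronglyMeasurable
  have hχ'm : ∀ m, AEStronglyMeasurable fun x => fderiv ℝ (χ m) x e := fun m =>
    (((hχ m).continuous_fderiv (by simp)).clm_apply continuous_const).aestronglyMeasurable
  have hright := tendsto_integral_mul_of_bounded hgF hχm hχ1 hχ_lim
  have hleft := (tendsto_integral_mul_of_bounded hwF hχ'm hχ'_le hχ'_lim).add
    (tendsto_integral_mul_of_bounded hwF' hχm hχ1 hχ_lim)
  rw [one_mul] at hright
  rw [zero_mul, zero_add, one_mul] at hleft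
  refine tendsto_nhds_unique hleft (hright.neg.congr fun m => ?_)
  have hprod : ∀ x, w x * fderiv ℝ (fun x => χ m x * F x) x e =
      fderiv ℝ (χ m) x e * (w x * F x) + χ m x * (w x * fderiv ℝ F x e) := fun x => by
    rw [fderiv_fun_mul ((hχ m).differentiable (by simp) x) (hF.differentiable (by simp) x)]
    simp only [FunLike.coe_add, FunLike.coe_smul, Pi.add_apply, Pi.smul_apply, smul_eq_mul]
    ring
  have htest := h.integral_eq _ ((hχ m).mul hF) (hχs m).mul_right i
  rw [integral_congr_ae (Eventually.of_forall hprod), integral_add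
    (hwF.bdd_mul (hχ'm m) (Eventually.of_forall (hχ'_le m)))
    (hwF'.bdd_mul (hχm m) (Eventually.of_forall (hχ1 m)))] at htest
  rw [htest]
  simp only [mul_left_comm]

theorem integral_mul_hermiteMulti {w : Space d → ℝ} {g : Space d → Space d}
    (h : HasWeakGradient w g) (hw : MemLp w 2 (gaussian d)) {i : Fin d}
    (hg : MemLp (fun x => g x i) 2 (gaussian d)) (k : Fin d → ℕ) :
    ∫ x, g x i * hermiteMulti k x ∂(gaussian d) =
      √((k i : ℝ) + 1) * ∫ x, w x * hermiteMulti (k + Pi.single i 1) x ∂(gaussian d) := by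
  have hint : ∀ {u : Space d → ℝ} (_ : MemLp u 2 (gaussian d)) (l : Fin d → ℕ),
      Integrable fun x => u x * (hermiteMulti l x * density d x) := fun hu l =>
    (integrable_gaussian_iff.1 (hu.integrable_mul (expGrowth_hermiteMulti l).memLp_two)).congr <|
      Eventually.of_forall fun x => by simp only [smul_eq_mul, Pi.mul_apply]; ring
  have hfderiv : ∀ x, w x * fderiv ℝ (fun x => hermiteMulti k x * density d x) x
      (EuclideanSpace.single i 1) =
      -√((k i : ℝ) + 1) * (w x * (hermiteMulti (k + Pi.single i 1) x * density d x)) := fun x => by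
    rw [← gradient_apply, gradient_hermiteMulti_mul_density]
    ring
  have key := h.integral_mul_fderiv_eq_neg ((contDiff_hermiteMulti k).mul contDiff_density)
    (hint hw k) (by simpa only [hfderiv] using (hint hw _).const_mul _) (hint hg k)
  simp only [hfderiv] at key
  rw [integral_const_mul, neg_mul, neg_inj] at key
  simp only [integral_gaussian, smul_eq_mul, mul_comm (density d _), mul_assoc]
  exact key.symm

end HasWeakGradient

theorem continuous_gradient {w : Space d → ℝ} (hw : ContDiff ℝ ∞ w) : Continuous (∇ w) :=
  (InnerProductSpace.toDual ℝ (Space d)).symm.continuous.comp (hw.continuous_fderiv (by simp))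

theorem hasWeakGradient_gradient {w : Space d → ℝ} (hw : ContDiff ℝ ∞ w) :
    HasWeakGradient w (∇ w) where
  locallyIntegrable := hw.continuous.locallyIntegrable
  locallyIntegrable_grad := (continuous_gradient hw).locallyIntegrable
  integral_eq := by
    intro φ hφ hφs i
    simp only [gradient_apply]
    have hw' : Continuous fun x => fderiv ℝ w x (EuclideanSpace.single i 1) :=
      (hw.continuous_fderiv (by simp)).clm_apply continuous_const
    have hφ' : Continuous fun x => fderiv ℝ φ x (EuclideanSpace.single i 1) :=
      (hφ.continuous_fderiv (by simp)).clm_apply continuous_const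
    exact integral_mul_fderiv_eq_neg_fderiv_mul_of_integrable
      ((hw'.mul hφ.continuous).integrable_of_hasCompactSupport hφs.mul_left)
      ((hw.continuous.mul hφ').integrable_of_hasCompactSupport
        (hφs.fderiv_apply (𝕜 := ℝ) _).mul_left)
      ((hw.continuous.mul hφ.continuous).integrable_of_hasCompactSupport hφs.mul_left)
      (fun x _ => hw.differentiable (by simp) x) (fun x _ => hφ.differentiable (by simp) x)

theorem integral_gradient_mul_hermiteMulti {f : Space d → ℝ} (hf : ContDiff ℝ ∞ f)
    (hfe : ExpGrowth f) (hfe' : ExpGrowth (∇ f)) (i : Fin d) (k : Fin d → ℕ) :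
    ∫ x, ∇ f x i * hermiteMulti k x ∂(gaussian d) =
      √((k i : ℝ) + 1) * ∫ x, f x * hermiteMulti (k + Pi.single i 1) x ∂(gaussian d) :=
  (hasWeakGradient_gradient hf).integral_mul_hermiteMulti hfe.memLp_two
    (hfe'.memLp_two.eval_piLp i) k

end WeakGradient

section MultiIndex

variable {d : ℕ}

theorem sum_add_single (k : Fin d → ℕ) (i : Fin d) :
    ∑ j, (k + Pi.single i 1 : Fin d → ℕ) j = ∑ j, k j + 1 := by
  simp [Finset.sum_add_distrib]

theorem exists_eq_add_single {k : Fin d → ℕ} {i : Fin d} (hk : k i ≠ 0) :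
    ∃ l : Fin d → ℕ, k = l + Pi.single i 1 :=
  ⟨k - Pi.single i 1, (tsub_add_cancel_of_le fun j => by
    rcases eq_or_ne j i with rfl | hj
    · simpa [Nat.one_le_iff_ne_zero] using hk
    · simp [hj]).symm⟩

theorem multiIndex_induction {P : (Fin d → ℕ) → Prop} (zero : P 0)
    (add_single : ∀ i k, P k → P (k + Pi.single i 1)) (k : Fin d → ℕ) : P k := by
  induction hn : ∑ j, k j generalizing k with
  | zero => exact (funext fun j => by simpa using Finset.sum_eq_zero_iff.1 hn j : k = 0) ▸ zero
  | succ n ih =>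
    obtain ⟨i, -, hi⟩ := Finset.exists_ne_zero_of_sum_ne_zero (hn.trans_ne n.succ_ne_zero)
    obtain ⟨l, rfl⟩ := exists_eq_add_single hi
    exact add_single i l (ih l (Nat.succ.inj ((sum_add_single l i).symm.trans hn)))

end MultiIndex

/-! ### Hermite polynomials as a Hilbert basis -/

section Orthonormality

variable {d : ℕ}

theorem integral_hermiteMulti_smul_mul_hermiteMulti (s : ℝ) {l k : Fin d → ℕ}
    (hlk : ∑ j, l j ≤ ∑ j, k j) :
    ∫ x, hermiteMulti l (s • x) * hermiteMulti k x ∂(gaussian d) =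
      if l = k then s ^ ∑ j, k j else 0 := by
  induction k using multiIndex_induction generalizing l with
  | zero =>
    have hl : l = 0 := by
      ext j
      simpa using (show ∀ j, l j = 0 by simpa using hlk) j
    simp [hl, hermiteMulti_zero]
  | add_single i k ih =>
    have hsqrt : ∀ m : ℕ, √((m : ℝ) + 1) ≠ 0 := fun m => by positivity
    have hgrad : ExpGrowth (∇ fun x => hermiteMulti l (s • x)) := by
      have := (ExpGrowth.const s).smul ((expGrowth_gradient_hermiteMulti l).comp_smul s)
      rwa [← funext (gradient_comp_smul (hermiteMulti l) s)] at this
    have h := integral_gradient_mul_hermiteMulti (f := fun x => hermiteMulti l (s • x))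
      ((contDiff_hermiteMulti l).comp (contDiff_const_smul s))
      ((expGrowth_hermiteMulti l).comp_smul s) hgrad i k
    simp only [gradient_comp_smul, PiLp.smul_apply, smul_eq_mul, gradient_hermiteMulti_apply,
      mul_assoc, integral_const_mul] at h
    refine mul_left_cancel₀ (hsqrt (k i)) (h.symm.trans ?_)
    rcases eq_or_ne (l i) 0 with hl | hl
    · have hne : l ≠ k + Pi.single i 1 := fun h => by simp [h] at hl
      simp [hl, hne]
    · obtain ⟨l, rfl⟩ := exists_eq_add_single hl
      rw [sum_add_single, sum_add_single, add_le_add_iff_right] at hlk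
      rw [add_tsub_cancel_right, ih hlk, sum_add_single]
      simp only [add_left_inj]
      split_ifs with hlk
      · rw [hlk, Pi.add_apply, Pi.single_eq_same, Nat.cast_add, Nat.cast_one]
        ring
      · simp

theorem integral_hermiteMulti_mul_hermiteMulti (l k : Fin d → ℕ) :
    ∫ x, hermiteMulti l x * hermiteMulti k x ∂(gaussian d) = if l = k then 1 else 0 := by
  rcases le_total (∑ j, l j) (∑ j, k j) with h | h
  · simpa using integral_hermiteMulti_smul_mul_hermiteMulti 1 h
  · simpa [mul_comm, eq_comm] using integral_hermiteMulti_smul_mul_hermiteMulti 1 h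

end Orthonormality

theorem ae_eq_zero_of_fourier_eq_zero {E : Type*} [NormedAddCommGroup E] [InnerProductSpace ℝ E]
    [CompleteSpace E] [SecondCountableTopology E] [MeasurableSpace E] [BorelSpace E]
    {μ : Measure E} {f : E → ℝ} (hf : Integrable f μ)
    (h : ∀ t, ∫ x, f x • Complex.exp (inner ℝ x t * Complex.I) ∂μ = 0) : f =ᵐ[μ] 0 := by
  have : IsFiniteMeasure (μ.withDensity fun x => ENNReal.ofReal (f x)) :=
    isFiniteMeasure_withDensity_ofReal hf.2
  have : IsFiniteMeasure (μ.withDensity fun x => ENNReal.ofReal (-f x)) :=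
    isFiniteMeasure_withDensity_ofReal hf.neg.2
  have hpos : AEMeasurable (fun x => ENNReal.ofReal (f x)) μ := hf.1.aemeasurable.ennreal_ofReal
  have hneg : AEMeasurable (fun x => ENNReal.ofReal (-f x)) μ :=
    hf.1.aemeasurable.neg.ennreal_ofReal
  have hexp : ∀ {u : E → ℝ} (t : E), Integrable u μ →
      Integrable (fun x => u x • Complex.exp (inner ℝ x t * Complex.I)) μ := fun t hu =>
    hu.norm.mono' (hu.1.smul (Continuous.aestronglyMeasurable (by fun_prop)))
      (Eventually.of_forall fun x => by rw [norm_smul, Complex.norm_exp_ofReal_mul_I, mul_one])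
  have hcharFun : (μ.withDensity fun x => ENNReal.ofReal (f x)) =
      μ.withDensity fun x => ENNReal.ofReal (-f x) := by
    refine Measure.ext_of_charFun (funext fun t => ?_)
    rw [charFun_apply, charFun_apply,
      integral_withDensity_eq_integral_toReal_smul₀ hpos (by simp),
      integral_withDensity_eq_integral_toReal_smul₀ hneg (by simp), ← sub_eq_zero]
    simp only [ENNReal.toReal_ofReal']
    rw [← integral_sub (hexp t hf.pos_part) (hexp t hf.neg_part), ← h t]
    simp only [← sub_smul, max_zero_sub_max_neg_zero_eq_self]
  filter_upwards [(withDensity_eq_iff hpos hneg hf.lintegral_lt_top.ne).1 hcharFun] with x hx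
  rcases le_total 0 (f x) with h0 | h0
  · rw [ENNReal.ofReal_of_nonpos (neg_nonpos.2 h0), ENNReal.ofReal_eq_zero] at hx
    exact le_antisymm hx h0
  · rw [ENNReal.ofReal_of_nonpos h0, eq_comm, ENNReal.ofReal_eq_zero] at hx
    exact le_antisymm h0 (neg_nonpos.1 hx)

section Totality

variable {d : ℕ}

theorem expGrowth_inner (t : Space d) : ExpGrowth fun x : Space d => inner ℝ t x :=
  ExpGrowth.clm (innerSL ℝ t)

theorem inner_mul_hermiteMulti (t : Space d) (k : Fin d → ℕ) (x : Space d) :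
    inner ℝ t x * hermiteMulti k x =
      ∑ i, (t i * √((k i : ℝ) + 1) * hermiteMulti (k + Pi.single i 1) x +
        t i * √(k i : ℝ) * hermiteMulti (k - Pi.single i 1) x) := by
  simp only [mul_assoc, sqrt_mul_hermiteMulti_add_single, ← mul_add, sub_add_cancel]
  rw [PiLp.inner_apply, Finset.sum_mul]
  simp [mul_comm, mul_left_comm]

theorem integral_mul_inner_pow_mul_hermiteMulti {f : Space d → ℝ} (hf : MemLp f 2 (gaussian d))
    (h : ∀ k, ∫ x, f x * hermiteMulti k x ∂(gaussian d) = 0) (t : Space d) (m : ℕ)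
    (k : Fin d → ℕ) :
    ∫ x, f x * inner ℝ t x ^ m * hermiteMulti k x ∂(gaussian d) = 0 := by
  induction m generalizing k with
  | zero => simpa using h k
  | succ m ih =>
    have hint : ∀ c l, Integrable (fun x => c * (f x * inner ℝ t x ^ m * hermiteMulti l x))
        (gaussian d) := fun c l => by
      simp only [mul_assoc]
      exact (hf.integrable_mul
        (((expGrowth_inner t).pow m).mul (expGrowth_hermiteMulti l)).memLp_two).const_mul c
    have hexpand : ∀ x : Space d, f x * inner ℝ t x ^ (m + 1) * hermiteMulti k x =
        ∑ i, (t i * √((k i : ℝ) + 1) *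
            (f x * inner ℝ t x ^ m * hermiteMulti (k + Pi.single i 1) x) +
          t i * √(k i : ℝ) *
            (f x * inner ℝ t x ^ m * hermiteMulti (k - Pi.single i 1) x)) := fun x => by
      rw [pow_succ, ← mul_assoc, mul_assoc, inner_mul_hermiteMulti, Finset.mul_sum]
      exact Finset.sum_congr rfl fun i _ => by ring
    simp only [hexpand]
    refine (integral_finsetSum _ fun i _ => (hint _ _).add (hint _ _)).trans
      (Finset.sum_eq_zero fun i _ => ?_)
    rw [integral_add' (hint _ _) (hint _ _), integral_const_mul, integral_const_mul, ih, ih]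
    simp

theorem hasSum_integral_smul_cexp_inner {f : Space d → ℝ} (hf : MemLp f 2 (gaussian d))
    (t : Space d) :
    HasSum (fun m : ℕ => (∫ x, f x * inner ℝ t x ^ m ∂(gaussian d) : ℝ) *
        (Complex.I ^ m / (m.factorial : ℂ)))
      (∫ x, f x • Complex.exp (inner ℝ x t * Complex.I) ∂(gaussian d)) := by
  have hbound : ∀ x : Space d, HasSum (fun m : ℕ => |f x| * ((‖t‖ * ‖x‖) ^ m / (m.factorial : ℝ)))
      (|f x| * Real.exp (‖t‖ * ‖x‖)) := fun x => by
    rw [Real.exp_eq_exp_ℝ]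
    exact (NormedSpace.expSeries_div_hasSum_exp (‖t‖ * ‖x‖)).mul_left _
  have hgrowth : ExpGrowth fun x : Space d => Real.exp (‖t‖ * ‖x‖) :=
    ⟨by fun_prop, 1, ‖t‖, fun x => by simp⟩
  have hterm : ∀ (m : ℕ) (x : Space d),
      ((f x * inner ℝ t x ^ m : ℝ) : ℂ) * (Complex.I ^ m / (m.factorial : ℂ)) =
        f x • ((inner ℝ x t * Complex.I) ^ m / (m.factorial : ℂ)) := fun m x => by
    rw [real_inner_comm, Complex.real_smul, mul_pow]
    push_cast
    ring
  simp only [← integral_complex_ofReal, ← integral_mul_const, hterm]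
  refine hasSum_integral_of_dominated_convergence
    (fun (m : ℕ) x => |f x| * ((‖t‖ * ‖x‖) ^ m / (m.factorial : ℝ)))
    (fun m => hf.1.smul (Continuous.aestronglyMeasurable (by fun_prop)))
    (fun m => Eventually.of_forall fun x => ?_)
    (Eventually.of_forall fun x => (hbound x).summable) ?_
    (Eventually.of_forall fun x => ?_)
  · rw [norm_smul, norm_div, norm_pow, norm_mul, Complex.norm_I, mul_one, Complex.norm_natCast,
      Complex.norm_real, Real.norm_eq_abs, Real.norm_eq_abs, mul_comm ‖t‖]
    gcongr
    exact abs_real_inner_le_norm x t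
  · simp only [fun x => (hbound x).tsum_eq]
    exact hf.norm.integrable_mul hgrowth.memLp_two
  · rw [Complex.exp_eq_exp_ℂ]
    exact (NormedSpace.expSeries_div_hasSum_exp _).const_smul _

theorem ae_eq_zero_of_integral_mul_hermiteMulti {f : Space d → ℝ} (hf : MemLp f 2 (gaussian d))
    (h : ∀ k, ∫ x, f x * hermiteMulti k x ∂(gaussian d) = 0) : f =ᵐ[gaussian d] 0 := by
  refine ae_eq_zero_of_fourier_eq_zero (hf.integrable one_le_two) fun t => ?_
  have hmoment : ∀ m, ∫ x, f x * inner ℝ t x ^ m ∂(gaussian d) = 0 := fun m => by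
    simpa only [hermiteMulti_zero, mul_one] using integral_mul_inner_pow_mul_hermiteMulti hf h t m 0
  refine (hasSum_integral_smul_cexp_inner hf t).unique ?_
  simpa only [hmoment, Complex.ofReal_zero, zero_mul] using hasSum_zero

theorem inner_toLp_toLp {α : Type*} [MeasurableSpace α] {μ : Measure α} {f g : α → ℝ}
    (hf : MemLp f 2 μ) (hg : MemLp g 2 μ) :
    inner ℝ (hf.toLp f) (hg.toLp g) = ∫ x, f x * g x ∂μ := by
  rw [L2.inner_def]
  refine integral_congr_ae ?_
  filter_upwards [hf.coeFn_toLp, hg.coeFn_toLp] with x hfx hgx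
  simp [hfx, hgx, mul_comm]

/-- The Hermite polynomial `H_k` as an element of `L²(gaussian d)`; these form a Hilbert basis. -/
def hermiteLp (k : Fin d → ℕ) : Lp ℝ 2 (gaussian d) :=
  (expGrowth_hermiteMulti k).memLp_two.toLp (hermiteMulti k)

theorem orthonormal_hermiteLp : Orthonormal ℝ (hermiteLp (d := d)) := by
  rw [orthonormal_iff_ite]
  intro k l
  rw [hermiteLp, hermiteLp, inner_toLp_toLp, integral_hermiteMulti_mul_hermiteMulti]

theorem span_hermiteLp_orthogonal :
    (Submodule.span ℝ (Set.range (hermiteLp (d := d))))ᗮ = ⊥ := by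
  rw [Submodule.eq_bot_iff]
  intro f hf
  have hfm := Lp.memLp f
  refine (Lp.eq_zero_iff_ae_eq_zero).2 (ae_eq_zero_of_integral_mul_hermiteMulti hfm fun k => ?_)
  rw [← inner_toLp_toLp hfm (expGrowth_hermiteMulti k).memLp_two, Lp.toLp_coeFn]
  exact (Submodule.mem_orthogonal' _ _).1 hf _ (Submodule.subset_span ⟨k, rfl⟩)

theorem hasSum_sq_integral_mul_hermiteMulti {f : Space d → ℝ} (hf : MemLp f 2 (gaussian d)) :
    HasSum (fun k => (∫ x, f x * hermiteMulti k x ∂(gaussian d)) ^ 2)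
      (∫ x, f x ^ 2 ∂(gaussian d)) := by
  have h := (HilbertBasis.mkOfOrthogonalEqBot orthonormal_hermiteLp
    span_hermiteLp_orthogonal).hasSum_inner_mul_inner (hf.toLp f) (hf.toLp f)
  simp only [HilbertBasis.coe_mkOfOrthogonalEqBot, real_inner_comm (hf.toLp f), ← sq] at h
  simpa only [hermiteLp, inner_toLp_toLp, ← sq] using h

end Totality

/-! ### The Poincaré inequality for functions without low Hermite modes -/

section Poincare

variable {d : ℕ}

theorem integral_norm_sq_eq_sum {α : Type*} [MeasurableSpace α] {μ : Measure α} {g : α → Space d}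
    (hg : MemLp g 2 μ) : ∫ x, ‖g x‖ ^ 2 ∂μ = ∑ i, ∫ x, g x i ^ 2 ∂μ := by
  rw [← integral_finsetSum _ fun i _ => (hg.eval_piLp i).integrable_sq]
  simp [EuclideanSpace.norm_sq_eq]

theorem HasWeakGradient.hasSum_mul_sq_integral_mul_hermiteMulti {w : Space d → ℝ}
    {g : Space d → Space d} (h : HasWeakGradient w g) (hw : MemLp w 2 (gaussian d)) {i : Fin d}
    (hg : MemLp (fun x => g x i) 2 (gaussian d)) :
    HasSum (fun k : Fin d → ℕ => (k i : ℝ) * (∫ x, w x * hermiteMulti k x ∂(gaussian d)) ^ 2)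
      (∫ x, g x i ^ 2 ∂(gaussian d)) := by
  rw [← (add_left_injective (Pi.single i 1 : Fin d → ℕ)).hasSum_iff]
  · convert! hasSum_sq_integral_mul_hermiteMulti hg using 1
    ext k
    rw [h.integral_mul_hermiteMulti hw hg, mul_pow, Real.sq_sqrt (by positivity)]
    simp
  · intro k hk
    have hki : k i = 0 := by
      by_contra hki
      obtain ⟨l, rfl⟩ := exists_eq_add_single hki
      exact hk ⟨l, rfl⟩
    simp [hki]

-- Expanded in Hermite polynomials, `Var[w] = ∑_{k ≠ 0} w_k²` and `∫ |g|² dμ = ∑_k |k| w_k²`.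
theorem HasWeakGradient.mul_variance_le {n : ℕ} {w : Space d → ℝ} {g : Space d → Space d}
    (h : HasWeakGradient w g) (hw : MemLp w 2 (gaussian d)) (hg : MemLp g 2 (gaussian d))
    (hmodes : ∀ k : Fin d → ℕ, 0 < ∑ j, k j → ∑ j, k j < n →
      ∫ x, w x * hermiteMulti k x ∂(gaussian d) = 0) :
    n * Var[w; gaussian d] ≤ ∫ x, ‖g x‖ ^ 2 ∂(gaussian d) := by
  have henergy := hasSum_sum (s := Finset.univ) fun i _ =>
    h.hasSum_mul_sq_integral_mul_hermiteMulti hw (hg.eval_piLp i)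
  have hvariance := ((hasSum_sq_integral_mul_hermiteMulti hw).sub
    (hasSum_ite_eq (0 : Fin d → ℕ) ((∫ x, w x ∂(gaussian d)) ^ 2))).mul_left (n : ℝ)
  rw [integral_norm_sq_eq_sum hg, ProbabilityTheory.variance_eq_sub hw]
  refine hasSum_le (fun k => ?_) hvariance henergy
  rw [← Finset.sum_mul]
  rcases eq_or_ne k 0 with rfl | hk
  · simp [hermiteMulti_zero]
  · rw [if_neg hk, sub_zero]
    rcases lt_or_ge (∑ j, k j) n with hlt | hge
    · have hpos : 0 < ∑ j, k j := by
        obtain ⟨i, hi⟩ := Function.ne_iff.1 hk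
        exact Finset.sum_pos' (fun _ _ => Nat.zero_le _) ⟨i, Finset.mem_univ i, hi.bot_lt⟩
      simp [hmodes k hpos hlt]
    · exact mul_le_mul_of_nonneg_right (by exact_mod_cast hge) (sq_nonneg _)

end Poincare

theorem lintegral_enorm_sq_eq {α E : Type*} [MeasurableSpace α] {μ : Measure α}
    [NormedAddCommGroup E] {g : α → E} (hg : MemLp g 2 μ) :
    ∫⁻ x, ‖g x‖ₑ ^ 2 ∂μ = ENNReal.ofReal (∫ x, ‖g x‖ ^ 2 ∂μ) := by
  rw [ofReal_integral_eq_lintegral_ofReal hg.norm.integrable_sq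
    (Eventually.of_forall fun x => by positivity)]
  simp only [ENNReal.ofReal_pow (norm_nonneg _), ofReal_norm]

theorem memLp_two_of_lintegral_enorm_sq_lt_top {α E : Type*} [MeasurableSpace α] {μ : Measure α}
    [NormedAddCommGroup E] {g : α → E} (hg : AEStronglyMeasurable g μ)
    (h : ∫⁻ x, ‖g x‖ₑ ^ 2 ∂μ < ⊤) : MemLp g 2 μ :=
  ⟨hg, (eLpNorm_lt_top_iff_lintegral_rpow_enorm_lt_top two_ne_zero ENNReal.ofNat_ne_top).2 <| by
    simpa using h⟩

theorem HasWeakGradient.ofReal_mul_variance_le {d n : ℕ} {w : Space d → ℝ} {g : Space d → Space d}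
    (h : HasWeakGradient w g) (hw : MemLp w 2 (gaussian d))
    (hmodes : ∀ k : Fin d → ℕ, 0 < ∑ j, k j → ∑ j, k j < n →
      ∫ x, w x * hermiteMulti k x ∂(gaussian d) = 0) :
    ENNReal.ofReal (n * Var[w; gaussian d]) ≤ ∫⁻ x, ‖g x‖ₑ ^ 2 ∂(gaussian d) := by
  rcases eq_or_ne (∫⁻ x, ‖g x‖ₑ ^ 2 ∂(gaussian d)) ⊤ with htop | htop
  · exact htop ▸ le_top
  have hg : MemLp g 2 (gaussian d) := memLp_two_of_lintegral_enorm_sq_lt_top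
    (h.locallyIntegrable_grad.aestronglyMeasurable.mono_ac gaussian_absolutelyContinuous)
    htop.lt_top
  rw [lintegral_enorm_sq_eq hg]
  exact ENNReal.ofReal_le_ofReal (h.mul_variance_le hw hg hmodes)

/-! ### The improved logarithmic Sobolev inequality -/

theorem lintegral_le_mul_lintegral_div {α : Type*} [MeasurableSpace α] {μ : Measure α} {w : α → ℝ}
    {M : ℝ} (hM : 0 < M) (hw : ∀ᵐ x ∂μ, w x ≤ M) (f : α → ℝ≥0∞) :
    ∫⁻ x, f x ∂μ ≤ ENNReal.ofReal M * ∫⁻ x, f x / ENNReal.ofReal (w x) ∂μ := by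
  rw [← lintegral_const_mul' _ _ ENNReal.ofReal_ne_top]
  refine lintegral_mono_ae (hw.mono fun x hx => ?_)
  calc f x = ENNReal.ofReal M * (f x / ENNReal.ofReal M) :=
        (ENNReal.mul_div_cancel (by simpa using hM) ENNReal.ofReal_ne_top).symm
    _ ≤ ENNReal.ofReal M * (f x / ENNReal.ofReal (w x)) := by gcongr

theorem ae_abs_le_toReal_eLpNorm_top {α : Type*} [MeasurableSpace α] {μ : Measure α} {w : α → ℝ}
    (hw : MemLp w ⊤ μ) : ∀ᵐ x ∂μ, |w x| ≤ (eLpNorm w ⊤ μ).toReal := by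
  filter_upwards [ae_le_eLpNormEssSup (f := w) (μ := μ)] with x hx
  rw [← Real.norm_eq_abs, ← toReal_enorm]
  exact ENNReal.toReal_mono hw.2.ne (eLpNorm_exponent_top (f := w) ▸ hx)

namespace Admissible

variable {d n : ℕ} {w : Space d → ℝ}

theorem ae_abs_le (h : Admissible n w) :
    ∀ᵐ x ∂(gaussian d), |w x| ≤ (eLpNorm w ⊤ volume).toReal :=
  gaussian_absolutelyContinuous.ae_le (ae_abs_le_toReal_eLpNorm_top h.memLp_top)

theorem aestronglyMeasurable (h : Admissible n w) : AEStronglyMeasurable w (gaussian d) :=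
  h.memLp_top.1.mono_ac gaussian_absolutelyContinuous

theorem memLp (h : Admissible n w) (p : ℝ≥0∞) : MemLp w p (gaussian d) :=
  MemLp.of_bound h.aestronglyMeasurable _ h.ae_abs_le

theorem integrable (h : Admissible n w) : Integrable w (gaussian d) :=
  (h.memLp 1).integrable le_rfl

theorem one_le_norm (h : Admissible n w) : 1 ≤ (eLpNorm w ⊤ volume).toReal := by
  calc (1 : ℝ) = ∫ x, w x ∂(gaussian d) := h.integral_eq_one.symm
    _ ≤ ∫ _, (eLpNorm w ⊤ volume).toReal ∂(gaussian d) :=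
        integral_mono_ae h.integrable (integrable_const _)
          (h.ae_abs_le.mono fun x hx => (le_abs_self _).trans hx)
    _ = (eLpNorm w ⊤ volume).toReal := by simp

theorem isBoundedUnder_ge (h : Admissible n w) : IsBoundedUnder (· ≥ ·) (ae volume) w :=
  ⟨0, h.nonneg⟩

theorem isCoboundedUnder_ge (h : Admissible n w) : IsCoboundedUnder (· ≥ ·) (ae volume) w :=
  IsBoundedUnder.isCoboundedUnder_ge ⟨(eLpNorm w ⊤ volume).toReal, eventually_map.2 <|
    (ae_abs_le_toReal_eLpNorm_top h.memLp_top).mono fun _ hx => (le_abs_self _).trans hx⟩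

theorem essInf_nonneg (h : Admissible n w) : 0 ≤ essInf w volume :=
  le_essInf_of_ae_le 0 h.nonneg h.isCoboundedUnder_ge

theorem H1_pos (h : Admissible n w) : 0 < H1 w :=
  mul_pos (zero_lt_one.trans_le h.one_le_norm) (h1_pos h.essInf_nonneg)

theorem integrable_mul_log (h : Admissible n w) :
    Integrable (fun x => w x * Real.log (w x)) (gaussian d) := by
  obtain ⟨C, hC⟩ := isCompact_Icc.exists_bound_of_continuousOn
    (Real.continuous_mul_log.continuousOn (s := Set.Icc (-(eLpNorm w ⊤ volume).toReal) _))
  exact Integrable.of_bound (Real.continuous_mul_log.comp_aestronglyMeasurable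
    h.aestronglyMeasurable) C (h.ae_abs_le.mono fun x hx => hC _ (abs_le.1 hx))

theorem variance_eq (h : Admissible n w) :
    Var[w; gaussian d] = ∫ x, (w x - 1) ^ 2 ∂(gaussian d) := by
  rw [ProbabilityTheory.variance_eq_integral h.aestronglyMeasurable.aemeasurable,
    h.integral_eq_one]

theorem integrable_sub_one_sq (h : Admissible n w) :
    Integrable (fun x => (w x - 1) ^ 2) (gaussian d) :=
  ((h.memLp 2).sub (memLp_const 1)).integrable_sq

theorem integrable_h1_mul_sq (h : Admissible n w) :
    Integrable (fun x => h1 (w x) * (w x - 1) ^ 2) (gaussian d) :=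
  (h.integrable_mul_log.sub (h.integrable.sub (integrable_const 1))).congr <|
    Eventually.of_forall fun x => by simp [mul_log_eq_add_h1_mul_sq (w x)]

theorem entropy_eq_integral_h1 (h : Admissible n w) :
    entropy w = ∫ x, h1 (w x) * (w x - 1) ^ 2 ∂(gaussian d) := by
  have hsub : ∫ x, (w x - 1) ∂(gaussian d) = 0 := by
    rw [integral_sub h.integrable (integrable_const 1), h.integral_eq_one]
    simp
  simp only [entropy, mul_log_eq_add_h1_mul_sq (w _)]
  rw [integral_add (f := fun x => w x - 1) (h.integrable.sub (integrable_const 1))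
    h.integrable_h1_mul_sq, hsub, zero_add]

theorem entropy_le (h : Admissible n w) :
    entropy w ≤ h1 (essInf w volume) * Var[w; gaussian d] := by
  rw [h.entropy_eq_integral_h1, h.variance_eq, ← integral_const_mul]
  refine integral_mono_ae h.integrable_h1_mul_sq (h.integrable_sub_one_sq.const_mul _) ?_
  filter_upwards [gaussian_absolutelyContinuous.ae_le (ae_essInf_le h.isBoundedUnder_ge)] with x hx
  exact mul_le_mul_of_nonneg_right
    (antitoneOn_h1 h.essInf_nonneg (h.essInf_nonneg.trans hx) hx) (sq_nonneg _)

theorem le_entropy (h : Admissible n w) {M : ℝ} (hM : ∀ᵐ x ∂(gaussian d), w x ≤ M) :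
    h1 M * Var[w; gaussian d] ≤ entropy w := by
  rw [h.entropy_eq_integral_h1, h.variance_eq, ← integral_const_mul]
  refine integral_mono_ae (h.integrable_sub_one_sq.const_mul _) h.integrable_h1_mul_sq ?_
  filter_upwards [hM, gaussian_absolutelyContinuous.ae_le h.nonneg] with x hx hpos
  exact mul_le_mul_of_nonneg_right (antitoneOn_h1 hpos (hpos.trans hx) hx) (sq_nonneg _)

theorem ofReal_entropy_le (h : Admissible n w) (hn : 1 ≤ n) :
    ENNReal.ofReal (entropy w) ≤ ENNReal.ofReal (H1 w / n) * fisher w := by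
  have hn' : (0 : ℝ) < n := by exact_mod_cast hn
  have hc : 0 < H1 w / n := div_pos h.H1_pos hn'
  have hcoeff : 0 ≤ h1 (essInf w volume) / n := div_nonneg (h1_pos h.essInf_nonneg).le hn'.le
  set M := (eLpNorm w ⊤ volume).toReal with hMdef
  simp only [fisher, ENNReal.mul_iInf_of_ne (ENNReal.ofReal_ne_zero_iff.2 hc) ENNReal.ofReal_ne_top]
  refine le_iInf₂ fun g hg => ?_
  calc ENNReal.ofReal (entropy w)
    _ ≤ ENNReal.ofReal (h1 (essInf w volume) / n * (n * Var[w; gaussian d])) := by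
        rw [← mul_assoc, div_mul_cancel₀ _ hn'.ne']
        exact ENNReal.ofReal_le_ofReal h.entropy_le
    _ = ENNReal.ofReal (h1 (essInf w volume) / n) * ENNReal.ofReal (n * Var[w; gaussian d]) :=
        ENNReal.ofReal_mul hcoeff
    _ ≤ ENNReal.ofReal (h1 (essInf w volume) / n) *
          (ENNReal.ofReal M * ∫⁻ x, ‖g x‖ₑ ^ 2 / ENNReal.ofReal (w x) ∂(gaussian d)) := by
        gcongr
        exact (hg.ofReal_mul_variance_le (h.memLp 2) h.integral_hermite).trans
          (lintegral_le_mul_lintegral_div (zero_lt_one.trans_le h.one_le_norm)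
            (h.ae_abs_le.mono fun _ hx => (le_abs_self _).trans hx) _)
    _ = ENNReal.ofReal (H1 w / n) * ∫⁻ x, ‖g x‖ₑ ^ 2 / ENNReal.ofReal (w x) ∂(gaussian d) := by
        rw [← mul_assoc, ← ENNReal.ofReal_mul hcoeff, H1, ← hMdef, div_mul_eq_mul_div,
          mul_comm M]

end Admissible

/-! ### Damped functions -/

section Damp

variable {d : ℕ} {F : Type*} [NormedAddCommGroup F] [NormedSpace ℝ F]

/-- The function `f (s • ·)` with the Gaussian weight that makes `damp s f * density` a rescaling
of `f * density`. For `s > 1` this turns functions of exponential growth into bounded ones; for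
`s = 1` it is the identity. -/
def damp (s : ℝ) (f : Space d → F) (x : Space d) : F :=
  Real.exp (-((s ^ 2 - 1) * ‖x‖ ^ 2 / 2)) • f (s • x)

theorem damp_one (f : Space d → F) : damp 1 f = f := by
  ext x
  simp [damp]

theorem density_smul_damp (s : ℝ) (f : Space d → F) (x : Space d) :
    density d x • damp s f x = density d (s • x) • f (s • x) := by
  rw [damp, smul_smul, density, density, mul_assoc, ← Real.exp_add, norm_smul, mul_pow,
    Real.norm_eq_abs, sq_abs]
  ring_nf

theorem integral_damp_mul {s : ℝ} (hs : s ≠ 0) (f g : Space d → ℝ) :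
    ∫ x, damp s f x * g x ∂(gaussian d) =
      |(s ^ d)⁻¹| * ∫ x, f x * g (s⁻¹ • x) ∂(gaussian d) := by
  have h := Measure.integral_comp_smul (volume : Measure (Space d))
    (fun x => density d x * (f x * g (s⁻¹ • x))) s
  have hdamp : ∀ x, density d x * damp s f x = density d (s • x) * f (s • x) :=
    density_smul_damp s f
  simpa only [integral_gaussian, smul_eq_mul, ← mul_assoc, hdamp, inv_smul_smul₀ hs,
    finrank_euclideanSpace_fin] using h

theorem integral_damp_hermiteMulti_mul_hermiteMulti {s : ℝ} (hs : s ≠ 0) {k l : Fin d → ℕ}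
    (hlk : ∑ j, l j < ∑ j, k j) :
    ∫ x, damp s (hermiteMulti k) x * hermiteMulti l x ∂(gaussian d) = 0 := by
  have hne : l ≠ k := fun h => hlk.ne (h ▸ rfl)
  simp only [integral_damp_mul hs, mul_comm (hermiteMulti k _),
    integral_hermiteMulti_smul_mul_hermiteMulti s⁻¹ hlk.le, if_neg hne, mul_zero]

theorem contDiff_damp (s : ℝ) {f : Space d → ℝ} (hf : ContDiff ℝ ∞ f) :
    ContDiff ℝ ∞ (damp s f) := by
  have hnorm : ContDiff ℝ ∞ fun x : Space d => ‖x‖ ^ 2 := contDiff_norm_sq ℝ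
  unfold damp
  fun_prop

theorem continuous_uncurry_damp {f : Space d → F} (hf : Continuous f) :
    Continuous fun p : ℝ × Space d => damp p.1 f p.2 := by
  unfold damp
  fun_prop

theorem gradient_damp (s : ℝ) {f : Space d → ℝ} (hf : Differentiable ℝ f) (x : Space d) :
    ∇ (damp s f) x = s • damp s (∇ f) x - ((s ^ 2 - 1) * damp s f x) • x := by
  have hexp := hasGradientAt_exp_neg_mul_norm_sq (s ^ 2 - 1) x
  have hdamp : damp s f = fun y => Real.exp (-((s ^ 2 - 1) * ‖y‖ ^ 2 / 2)) * f (s • y) := rfl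
  rw [hdamp, gradient_fun_mul hexp.differentiableAt (by fun_prop), hexp.gradient,
    gradient_comp_smul, damp]
  module

theorem ExpGrowth.exists_norm_damp_le {f : Space d → F} (hf : ExpGrowth f) {s : ℝ} (hs : 1 < s) :
    ∃ M, ∀ x, ‖damp s f x‖ ≤ M := by
  obtain ⟨-, C, a, hf⟩ := hf
  have hC : 0 ≤ C := by simpa using (norm_nonneg _).trans (hf 0)
  have hs' : 0 < s ^ 2 - 1 := by nlinarith
  refine ⟨C * Real.exp ((a * s) ^ 2 / (2 * (s ^ 2 - 1))), fun x => ?_⟩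
  have hexponent : -((s ^ 2 - 1) * ‖x‖ ^ 2 / 2) + a * (s * ‖x‖) ≤
      (a * s) ^ 2 / (2 * (s ^ 2 - 1)) := by
    rw [le_div_iff₀ (by positivity)]
    nlinarith [sq_nonneg ((s ^ 2 - 1) * ‖x‖ - a * s)]
  calc ‖damp s f x‖ = Real.exp (-((s ^ 2 - 1) * ‖x‖ ^ 2 / 2)) * ‖f (s • x)‖ := by
        rw [damp, norm_smul, Real.norm_eq_abs, Real.abs_exp]
    _ ≤ Real.exp (-((s ^ 2 - 1) * ‖x‖ ^ 2 / 2)) * (C * Real.exp (a * (s * ‖x‖))) := by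
        gcongr
        simpa only [norm_smul, Real.norm_of_nonneg (zero_lt_one.trans hs).le] using hf (s • x)
    _ = C * Real.exp (-((s ^ 2 - 1) * ‖x‖ ^ 2 / 2) + a * (s * ‖x‖)) := by
        rw [Real.exp_add, mul_left_comm]
    _ ≤ C * Real.exp ((a * s) ^ 2 / (2 * (s ^ 2 - 1))) := by gcongr

theorem ExpGrowth.exists_dominating_damp {f : Space d → F} (hf : ExpGrowth f) :
    ∃ g : Space d → ℝ, ExpGrowth g ∧ ∀ s ∈ Set.Icc (1 : ℝ) 2, ∀ x, ‖damp s f x‖ ≤ g x := by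
  obtain ⟨-, C, a, hf⟩ := hf
  have hC : 0 ≤ C := by simpa using (norm_nonneg _).trans (hf 0)
  refine ⟨fun x => C * Real.exp (|a| * 2 * ‖x‖), ⟨by fun_prop, C, |a| * 2, fun x => ?_⟩,
    fun s hs x => ?_⟩
  · rw [Real.norm_of_nonneg (by positivity)]
  have hexp : Real.exp (-((s ^ 2 - 1) * ‖x‖ ^ 2 / 2)) ≤ 1 := by
    rw [Real.exp_le_one_iff, neg_nonpos]
    have : 0 ≤ s ^ 2 - 1 := by nlinarith [hs.1]
    positivity
  calc ‖damp s f x‖ ≤ ‖f (s • x)‖ := by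
        rw [damp, norm_smul, Real.norm_eq_abs, Real.abs_exp]
        exact mul_le_of_le_one_left (norm_nonneg _) hexp
    _ ≤ C * Real.exp (a * ‖s • x‖) := hf _
    _ ≤ C * Real.exp (|a| * 2 * ‖x‖) := by
        have hs0 : 0 ≤ s := zero_le_one.trans hs.1
        rw [norm_smul, Real.norm_of_nonneg hs0, ← mul_assoc]
        gcongr
        · exact le_abs_self a
        · exact hs.2

theorem exists_dominating_gradient_damp {f : Space d → ℝ} (hf : Differentiable ℝ f)
    (hfe : ExpGrowth f) (hfe' : ExpGrowth (∇ f)) :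
    ∃ g : Space d → ℝ, ExpGrowth g ∧ ∀ s ∈ Set.Icc (1 : ℝ) 2, ∀ x, ‖∇ (damp s f) x‖ ≤ g x := by
  obtain ⟨g₀, hg₀, h₀⟩ := hfe.exists_dominating_damp
  obtain ⟨g₁, hg₁, h₁⟩ := hfe'.exists_dominating_damp
  refine ⟨fun x => 2 * g₁ x + 3 * g₀ x * ‖x‖, ((ExpGrowth.const 2).mul hg₁).add
    (((ExpGrowth.const 3).mul hg₀).mul (ExpGrowth.clm (.id ℝ (Space d))).norm), fun s hs x => ?_⟩
  have hs0 : 0 ≤ s := zero_le_one.trans hs.1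
  have hs1 : 0 ≤ s ^ 2 - 1 := by nlinarith [hs.1]
  have hs3 : s ^ 2 - 1 ≤ 3 := by nlinarith [hs.2]
  calc ‖∇ (damp s f) x‖ ≤ ‖s • damp s (∇ f) x‖ + ‖((s ^ 2 - 1) * damp s f x) • x‖ := by
        rw [gradient_damp s hf]
        exact norm_sub_le _ _
    _ = s * ‖damp s (∇ f) x‖ + (s ^ 2 - 1) * ‖damp s f x‖ * ‖x‖ := by
        rw [norm_smul, norm_smul, norm_mul, Real.norm_of_nonneg hs0, Real.norm_of_nonneg hs1]
    _ ≤ 2 * g₁ x + 3 * g₀ x * ‖x‖ := by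
        gcongr
        exacts [hs.2, h₁ s hs x, h₀ s hs x]

end Damp

theorem continuousOn_integral_norm_sq {d : ℕ} {F : Type*} [NormedAddCommGroup F]
    {u : ℝ → Space d → F} (hu : Continuous fun p : ℝ × Space d => u p.1 p.2) {S : Set ℝ}
    {g : Space d → ℝ} (hg : ExpGrowth g) (hug : ∀ s ∈ S, ∀ x, ‖u s x‖ ≤ g x) :
    ContinuousOn (fun s => ∫ x, ‖u s x‖ ^ 2 ∂(gaussian d)) S := by
  refine continuousOn_of_dominated (bound := fun x => g x ^ 2)
    (fun s _ => Continuous.aestronglyMeasurable (by fun_prop)) (fun s hs => .of_forall fun x => ?_)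
    (hg.pow 2).integrable (.of_forall fun x => Continuous.continuousOn (by fun_prop))
  rw [norm_pow, norm_norm]
  gcongr
  exact hug s hs x

theorem integral_norm_gradient_hermiteMulti_sq {d : ℕ} (k : Fin d → ℕ) :
    ∫ x, ‖∇ (hermiteMulti k) x‖ ^ 2 ∂(gaussian d) = ∑ i, (k i : ℝ) := by
  rw [integral_norm_sq_eq_sum (expGrowth_gradient_hermiteMulti k).memLp_two]
  refine Finset.sum_congr rfl fun i _ => ?_
  simp only [gradient_hermiteMulti_apply, mul_pow, Real.sq_sqrt (Nat.cast_nonneg _),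
    integral_const_mul]
  simp only [pow_two, integral_hermiteMulti_mul_hermiteMulti, if_true, mul_one]

theorem exists_damp_hermiteMulti_lt {d : ℕ} (k : Fin d → ℕ) {c : ℝ} (hc : c * ∑ i, (k i : ℝ) < 1) :
    ∃ s ∈ Set.Ioc (1 : ℝ) 2, c * ∫ x, ‖∇ (damp s (hermiteMulti k)) x‖ ^ 2 ∂(gaussian d) <
      ∫ x, damp s (hermiteMulti k) x ^ 2 ∂(gaussian d) := by
  have hH := (contDiff_hermiteMulti k).differentiable (by simp)
  obtain ⟨g₀, hg₀, h₀⟩ := (expGrowth_hermiteMulti k).exists_dominating_damp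
  obtain ⟨g₁, hg₁, h₁⟩ := exists_dominating_gradient_damp hH (expGrowth_hermiteMulti k)
    (expGrowth_gradient_hermiteMulti k)
  have hcont₀ := continuousOn_integral_norm_sq
    (continuous_uncurry_damp (contDiff_hermiteMulti k).continuous) hg₀ h₀
  have hcont₁ := continuousOn_integral_norm_sq (u := fun s => ∇ (damp s (hermiteMulti k)))
    (by
      simp only [gradient_damp _ hH]
      have := continuous_uncurry_damp (contDiff_hermiteMulti k).continuous
      have := continuous_uncurry_damp (continuous_gradient (contDiff_hermiteMulti k))
      fun_prop) hg₁ h₁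
  simp only [Real.norm_eq_abs, sq_abs] at hcont₀
  have hone : (1 : ℝ) ∈ Set.Icc (1 : ℝ) 2 := ⟨le_rfl, one_le_two⟩
  have hlt : c * ∫ x, ‖∇ (damp 1 (hermiteMulti k)) x‖ ^ 2 ∂(gaussian d) <
      ∫ x, damp 1 (hermiteMulti k) x ^ 2 ∂(gaussian d) := by
    rw [damp_one, integral_norm_gradient_hermiteMulti_sq]
    simpa only [pow_two, integral_hermiteMulti_mul_hermiteMulti, if_true] using hc
  have hev := (((hcont₁ 1 hone).const_mul c).eventually_lt (hcont₀ 1 hone) hlt).filter_mono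
    (nhdsWithin_mono 1 Set.Ioc_subset_Icc_self)
  rw [nhdsWithin_Ioc_eq_nhdsGT one_lt_two] at hev
  obtain ⟨s, h, hs⟩ := (hev.and (Ioc_mem_nhdsGT one_lt_two)).exists
  exact ⟨s, hs, h⟩

/-! ### Perturbations of the constant function -/

theorem fisher_le {d : ℕ} {w : Space d → ℝ} (hw : ContDiff ℝ ∞ w) {m : ℝ} (hm : 0 < m)
    (hmw : ∀ x, m ≤ w x) (hgrad : MemLp (∇ w) 2 (gaussian d)) :
    fisher w ≤ ENNReal.ofReal ((∫ x, ‖∇ w x‖ ^ 2 ∂(gaussian d)) / m) := by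
  refine (iInf₂_le (∇ w) (hasWeakGradient_gradient hw)).trans ?_
  rw [ENNReal.ofReal_div_of_pos hm, ← lintegral_enorm_sq_eq hgrad, div_eq_mul_inv,
    ← lintegral_mul_const' _ _ (by simpa using hm)]
  refine lintegral_mono fun x => ?_
  rw [div_eq_mul_inv]
  gcongr
  exact hmw x

namespace Admissible

variable {d n : ℕ} {w : Space d → ℝ}

theorem H1_le (h : Admissible n w) {η : ℝ} (hη : η < 1) (hw : ∀ x, |w x - 1| ≤ η) :
    H1 w ≤ (1 + η) / (2 * (1 - η)) := by
  have hη0 : 0 ≤ η := (abs_nonneg _).trans (hw 0)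
  have hnorm : (eLpNorm w ⊤ volume).toReal ≤ 1 + η := by
    refine ENNReal.toReal_le_of_le_ofReal (by linarith) ?_
    rw [eLpNorm_exponent_top]
    refine eLpNormEssSup_le_of_ae_bound (Eventually.of_forall fun x => ?_)
    calc ‖w x‖ = |1 + (w x - 1)| := by rw [Real.norm_eq_abs, add_sub_cancel]
      _ ≤ 1 + η := (abs_add_le _ _).trans (by rw [abs_one]; linarith [hw x])
  have hinf : 1 - η ≤ essInf w volume :=
    le_essInf_of_ae_le _ (Eventually.of_forall fun x => by
      linarith [(abs_le.1 (hw x)).1]) h.isCoboundedUnder_ge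
  have hh1 : h1 (essInf w volume) ≤ 1 / 2 / (1 - η) :=
    (antitoneOn_h1 (Set.mem_Ici.2 (by linarith)) h.essInf_nonneg hinf).trans
      (h1_le_one_half_div (by linarith) (by linarith))
  calc H1 w ≤ (1 + η) * (1 / 2 / (1 - η)) :=
        mul_le_mul hnorm hh1 (h1_pos h.essInf_nonneg).le (by linarith)
    _ = (1 + η) / (2 * (1 - η)) := by rw [div_div, mul_one_div]

theorem mul_H1_mul_fisher_lt (h : Admissible n w) (hw : ContDiff ℝ ∞ w)
    (hgrad : MemLp (∇ w) 2 (gaussian d)) {η : ℝ} (hη : η < 1) (hwη : ∀ x, |w x - 1| ≤ η)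
    {c : ℝ} (hc : 0 ≤ c)
    (hlt : c * ((1 + η) / (1 - η)) ^ 2 * ∫ x, ‖∇ w x‖ ^ 2 ∂(gaussian d) < Var[w; gaussian d]) :
    ENNReal.ofReal (c * H1 w) * fisher w < ENNReal.ofReal (entropy w) := by
  set D := ∫ x, ‖∇ w x‖ ^ 2 ∂(gaussian d)
  have hη0 : 0 ≤ η := (abs_nonneg _).trans (hwη 0)
  have hη1 : 0 < 1 - η := sub_pos.2 hη
  have hD : 0 ≤ D := integral_nonneg fun x => sq_nonneg _
  have hfisher : fisher w ≤ ENNReal.ofReal (D / (1 - η)) :=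
    fisher_le hw hη1 (fun x => by linarith [(abs_le.1 (hwη x)).1]) hgrad
  have hentropy : c * ((1 + η) / (2 * (1 - η))) * (D / (1 - η)) < entropy w :=
    calc c * ((1 + η) / (2 * (1 - η))) * (D / (1 - η))
      _ = 1 / 2 / (1 + η) * (c * ((1 + η) / (1 - η)) ^ 2 * D) := by field_simp
      _ < 1 / 2 / (1 + η) * Var[w; gaussian d] := by gcongr
      _ ≤ h1 (1 + η) * Var[w; gaussian d] :=
          mul_le_mul_of_nonneg_right (one_half_div_le_h1 (by linarith))
            (ProbabilityTheory.variance_nonneg _ _)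
      _ ≤ entropy w :=
          h.le_entropy (Eventually.of_forall fun x => by linarith [(abs_le.1 (hwη x)).2])
  calc ENNReal.ofReal (c * H1 w) * fisher w
    _ ≤ ENNReal.ofReal (c * ((1 + η) / (2 * (1 - η)))) * ENNReal.ofReal (D / (1 - η)) := by
        gcongr
        exact h.H1_le hη hwη
    _ = ENNReal.ofReal (c * ((1 + η) / (2 * (1 - η))) * (D / (1 - η))) :=
        (ENNReal.ofReal_mul (by positivity)).symm
    _ < ENNReal.ofReal (entropy w) :=
        (ENNReal.ofReal_lt_ofReal_iff_of_nonneg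
          (mul_nonneg (by positivity) (div_nonneg hD hη1.le))).2 hentropy

end Admissible

section Perturbation

variable {d n : ℕ} {f : Space d → ℝ}

theorem integral_one_add_mul_mul_hermiteMulti (hf : MemLp f 2 (gaussian d)) (ε : ℝ)
    (k : Fin d → ℕ) :
    ∫ x, (1 + ε * f x) * hermiteMulti k x ∂(gaussian d) =
      (if k = 0 then 1 else 0) + ε * ∫ x, f x * hermiteMulti k x ∂(gaussian d) := by
  have hk := integral_hermiteMulti_mul_hermiteMulti k 0
  simp only [hermiteMulti_zero, mul_one] at hk
  simp only [add_mul, one_mul, mul_assoc]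
  have hint : Integrable (fun x => f x * hermiteMulti k x) (gaussian d) :=
    hf.integrable_mul (expGrowth_hermiteMulti k).memLp_two
  rw [integral_add (expGrowth_hermiteMulti k).integrable (hint.const_mul ε), integral_const_mul, hk]

theorem abs_mul_le_of_abs_le {M ε : ℝ} (hε : 0 ≤ ε) (hM : ∀ x, |f x| ≤ M) (x : Space d) :
    |ε * f x| ≤ ε * M := by
  rw [abs_mul, abs_of_nonneg hε]
  exact mul_le_mul_of_nonneg_left (hM x) hε

theorem admissible_one_add_mul (hn : 1 ≤ n) (hf : Continuous f) {M ε : ℝ} (hM : ∀ x, |f x| ≤ M)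
    (hε : 0 ≤ ε) (hεM : ε * M ≤ 1)
    (hmodes : ∀ k : Fin d → ℕ, ∑ j, k j < n → ∫ x, f x * hermiteMulti k x ∂(gaussian d) = 0) :
    Admissible n fun x => 1 + ε * f x := by
  have hf2 : MemLp f 2 (gaussian d) := (ExpGrowth.of_bounded hf hM).memLp_two
  have hεf := abs_mul_le_of_abs_le hε hM
  refine ⟨?_, .of_forall fun x => ?_, ?_, fun k hk0 hk => ?_⟩
  · refine memLp_top_of_bound (Continuous.aestronglyMeasurable (by fun_prop)) (1 + ε * M)
      (.of_forall fun x => (norm_add_le _ _).trans ?_)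
    rw [norm_one]
    exact add_le_add_right (hεf x) 1
  · linarith [(abs_le.1 (hεf x)).1]
  · have h := integral_one_add_mul_mul_hermiteMulti hf2 ε 0
    rw [hmodes 0 (by simpa [Nat.pos_iff_ne_zero, Nat.one_le_iff_ne_zero] using hn)] at h
    simpa [hermiteMulti_zero] using h
  · have hne : k ≠ 0 := by
      rintro rfl
      simp at hk0
    rw [integral_one_add_mul_mul_hermiteMulti hf2, hmodes k hk, if_neg hne, mul_zero, add_zero]

theorem gradient_one_add_mul (hf : ContDiff ℝ ∞ f) (ε : ℝ) :
    ∇ (fun x => 1 + ε * f x) = fun x => ε • ∇ f x := by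
  ext x i
  rw [gradient_apply, fderiv_const_add, fderiv_const_mul (hf.differentiable (by simp) x),
    PiLp.smul_apply, gradient_apply, smul_apply]

theorem exists_admissible_one_add_mul_lt (hn : 1 ≤ n) (hf : ContDiff ℝ ∞ f) {M : ℝ}
    (hM : ∀ x, |f x| ≤ M) (hgrad : MemLp (∇ f) 2 (gaussian d))
    (hmodes : ∀ k : Fin d → ℕ, ∑ j, k j < n → ∫ x, f x * hermiteMulti k x ∂(gaussian d) = 0)
    {c : ℝ} (hc : 0 ≤ c)
    (hlt : c * ∫ x, ‖∇ f x‖ ^ 2 ∂(gaussian d) < ∫ x, f x ^ 2 ∂(gaussian d)) {δ : ℝ} (hδ : 0 < δ) :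
    ∃ w : Space d → ℝ, Admissible n w ∧ ContDiff ℝ ∞ w ∧ (∀ x, |w x - 1| ≤ δ) ∧
      ENNReal.ofReal (c * H1 w) * fisher w < ENNReal.ofReal (entropy w) := by
  set D := ∫ x, ‖∇ f x‖ ^ 2 ∂(gaussian d) with hD
  set V := ∫ x, f x ^ 2 ∂(gaussian d) with hV
  have hsmall : ∀ {b : ℝ}, 0 < b → ∀ᶠ ε in 𝓝 (0 : ℝ), ε * M < b := fun hb =>
    ((continuous_mul_const M).tendsto 0).eventually_lt_const (by simpa using hb)
  have hratio : ∀ᶠ ε in 𝓝 (0 : ℝ), c * ((1 + ε * M) / (1 - ε * M)) ^ 2 * D < V := by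
    have hcont : ContinuousAt (fun ε : ℝ => c * ((1 + ε * M) / (1 - ε * M)) ^ 2 * D) 0 := by
      fun_prop (disch := simp)
    exact hcont.eventually_lt_const (by simpa using hlt)
  obtain ⟨ε, ⟨hεδ, hεM, hεlt⟩, hε⟩ :=
    ((((hsmall hδ).and ((hsmall one_pos).and hratio)).filter_mono nhdsWithin_le_nhds).and
      (self_mem_nhdsWithin (s := Set.Ioi (0 : ℝ)))).exists
  have hw := admissible_one_add_mul hn hf.continuous hM hε.le hεM.le hmodes
  have hwc : ContDiff ℝ ∞ fun x => 1 + ε * f x := by fun_prop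
  have hwη : ∀ x, |1 + ε * f x - 1| ≤ ε * M := by
    simpa only [add_sub_cancel_left] using abs_mul_le_of_abs_le hε.le hM
  refine ⟨_, hw, hwc, fun x => (hwη x).trans hεδ.le, hw.mul_H1_mul_fisher_lt hwc ?_ hεM hwη hc ?_⟩
  · rw [gradient_one_add_mul hf]
    exact hgrad.const_smul ε
  · simp only [hw.variance_eq, gradient_one_add_mul hf, norm_smul, mul_pow, Real.norm_eq_abs,
      sq_abs, add_sub_cancel_left, integral_const_mul, ← hD, ← hV]
    rw [mul_left_comm]
    gcongr

end Perturbation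

theorem exists_admissible_lt {d n : ℕ} (hd : 1 ≤ d) (hn : 1 ≤ n) {c : ℝ} (hc : 0 ≤ c)
    (hcn : c * n < 1) {δ : ℝ} (hδ : 0 < δ) :
    ∃ w : Space d → ℝ, Admissible n w ∧ ContDiff ℝ ∞ w ∧ (∀ x, |w x - 1| ≤ δ) ∧
      ENNReal.ofReal (c * H1 w) * fisher w < ENNReal.ofReal (entropy w) := by
  let k : Fin d → ℕ := Pi.single ⟨0, hd⟩ n
  have hk : ∑ j, k j = n := by simp [k]
  have hH := contDiff_hermiteMulti k
  obtain ⟨s, hs, hlt⟩ := exists_damp_hermiteMulti_lt k (c := c) (by rwa [← Nat.cast_sum, hk])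
  obtain ⟨M, hM⟩ := (expGrowth_hermiteMulti k).exists_norm_damp_le hs.1
  obtain ⟨g, hg, hgrad⟩ := exists_dominating_gradient_damp (hH.differentiable (by simp))
    (expGrowth_hermiteMulti k) (expGrowth_gradient_hermiteMulti k)
  refine exists_admissible_one_add_mul_lt hn (contDiff_damp s hH) hM
    (hg.memLp_two.mono' (continuous_gradient (contDiff_damp s hH)).aestronglyMeasurable
      (.of_forall (hgrad s (Set.Ioc_subset_Icc_self hs))))
    (fun l hl => integral_damp_hermiteMulti_mul_hermiteMulti (by linarith [hs.1]) (by rwa [hk]))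
    hc hlt hδ

end ImprovedLogSobolev

end

open ImprovedLogSobolev in
/-- The improved logarithmic Sobolev inequality, and the optimality of its constant: `1 / n`
cannot be lowered, not even for smooth functions that are uniformly close to `1`. -/
theorem theorem1 (d n : ℕ) (hd : 1 ≤ d) (hn : 1 ≤ n) :
    (∀ w : Space d → ℝ, Admissible n w →
      ENNReal.ofReal (entropy w) ≤ ENNReal.ofReal (H1 w / n) * fisher w) ∧
    (∀ c : ℝ, c < 1 / n → ∀ δ : ℝ, 0 < δ →
      ∃ w : Space d → ℝ, Admissible n w ∧ ContDiff ℝ ∞ w ∧ (∀ x, |w x - 1| ≤ δ) ∧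
        ENNReal.ofReal (c * H1 w) * fisher w < ENNReal.ofReal (entropy w)) := by
  refine ⟨fun w hw => hw.ofReal_entropy_le hn, fun c hc δ hδ => ?_⟩
  have hn0 : (0 : ℝ) < n := by exact_mod_cast hn
  have hcn : max c 0 * n < 1 := by
    rw [← lt_div_iff₀ hn0]
    exact max_lt hc (by positivity)
  obtain ⟨w, hw, hwc, hwδ, hlt⟩ := exists_admissible_lt hd hn (le_max_right c 0) hcn hδ
  refine ⟨w, hw, hwc, hwδ, lt_of_le_of_lt ?_ hlt⟩
  gcongr
  · exact hw.H1_pos.le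
  · exact le_max_left c 0
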